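/- Let $\mathscr{C}=(\mathscr{C},\otimes,\mathbb{1})$ be a rigidly-compactly generated tensor-triangulated category with small products: a triangulated category with small coproducts and products and a closed symmetric monoidal structure whose tensor product is exact in each variable, such that the compact objects are essentially small, generate $\mathscr{C}$, and coincide with the rigid (dualizable) objects. (For instance, the homotopy category of a rigidly-compactly generated stable symmetric monoidal $\infty$-category whose tensor product preserves colimits in each variable. Products, the functors below and equivalences of objects of such an $\infty$-category are all detected in its homotopy category.) Let $\operatorname{Spc}(\mathscr{C}^\omega)$ be the Balmer spectrum, i.e. the set of (proper) prime thick $\otimes$-ideals $\mathfrak{p}$ of the category $\mathscr{C}^\omega$ of compact objects, with closed sets generated by the supports $\operatorname{supp}(K)=\{\mathfrak{p}\mid K\notin\mathfrak{p}\}$, $K\in\mathscr{C}^\omega$. Assume that it is a Noetherian space of finite dimension $d$. Order it by $\mathfrak{q}\leqslant\mathfrak{p}$ iff $\mathfrak{q}\in\overline{\{\mathfrak{p}\}}$; the dimension of an element of a poset is the supremum of the lengths of chains descending from it. For a specialization closed subset $V$ of $\operatorname{Spc}(\mathscr{C}^\omega)$ let $\Gamma_V\mathscr{C}$ be the localizing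 $\otimes$-ideal generated by the compact objects $K$ with $\operatorname{supp}(K)=\overline{\{\mathfrak{p}\}}$ for some $\mathfrak{p}\in V$; let $L_{V^c}\mathscr{C}=(\Gamma_V\mathscr{C})^\perp$ and $\Lambda_V\mathscr{C}=(L_{V^c}\mathscr{C})^\perp$ be the iterated right orthogonals. Let $\Gamma_V$ be the right adjoint of the inclusion $\Gamma_V\mathscr{C}\subseteq\mathscr{C}$, and let $L_{V^c}$, $\Lambda_V$ be the left adjoints of the inclusions of $L_{V^c}\mathscr{C}$ and $\Lambda_V\mathscr{C}$, all viewed as endofunctors of $\mathscr{C}$. Write $\Gamma_{\leqslant i}=\Gamma_{\{\dim\mathfrak{p}\leqslant i\}}$, $L_{\geqslant i}=L_{\{\dim\mathfrak{p}\geqslant i\}}$ and $E_i=\Gamma_{\leqslant i}L_{\geqslant i}\mathbb{1}$. Let $(\mathscr{A},\alpha)$ be assembly data: a subset $\mathscr{A}\subseteq\operatorname{Spc}(\mathscr{C}^\omega)$ with the induced order and an order-preserving map $\alpha\colon\operatorname{Spc}(\mathscr{C}^\omega)\to\mathscr{A}$ such that $\alpha(x)=x$ for $x\in\mathscr{A}$,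 and such that the dimension of $\alpha(\mathfrak{p})$ in $\mathscr{A}$ equals the dimension of $\mathfrak{p}$ in $\operatorname{Spc}(\mathscr{C}^\omega)$ for all $\mathfrak{p}$. For $x\in\mathscr{A}$ put $L^{\mathscr{A}}_x=L_{\{\mathfrak{p}\,\mid\,\alpha(\mathfrak{p})\geqslant x\}}$ and $\Lambda^{\mathscr{A}}_x=\Lambda_{\{\mathfrak{p}\,\mid\,\alpha(\mathfrak{p})\leqslant x\}}$, and let $$\mathbb{1}^{\mathscr{A}}_{\mathrm{ad}}(i)=\prod_{x\in\mathscr{A},\ \dim x=i}L^{\mathscr{A}}_x\Lambda^{\mathscr{A}}_x\mathbb{1}.$$ Then for every $0\leqslant i\leqslant d$: (a) for every $X\in\mathscr{C}$ there is an isomorphism in $\mathscr{C}$ $$\Gamma_{\leqslant i}\prod_{x\in\mathscr{A},\ \dim x=i}L^{\mathscr{A}}_xX\;\simeq\;E_i\otimes X;$$ (b) there is an isomorphism $E_i\simeq E_i\otimes\mathbb{1}^{\mathscr{A}}_{\mathrm{ad}}(i)$ in $\mathscr{C}$. -/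

import Mathlib

open CategoryTheory Limits Pretriangulated MonoidalCategory Opposite

universe v u

namespace TTGeometry

set_option linter.unusedSectionVars false

/-! ### Compact objects and rigidly-compactly generated categories -/

section
variable (C : Type u) [Category.{v} C] [Preadditive C]

/-- An object `K` is compact if the functor `Hom(K, -)`, with values in abelian groups,
preserves all small coproducts. -/
def compactObjects : ObjectProperty C := fun K =>
  ∀ J : Type v, PreservesColimitsOfShape (Discrete J) (preadditiveCoyoneda.obj (op K))

/-- A tensor-triangulated category is rigidly-compactly generated if its compact objects are
essentially small, generate it (the class of compact objects is stable under shifts, so that no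
shifts are needed in the second field), and coincide with the rigid (i.e. dualizable) objects. -/
class IsRigidlyCompactlyGenerated [MonoidalCategory C] : Prop where
  essentiallySmall : ObjectProperty.EssentiallySmall.{v} (compactObjects C)
  isZero_of_forall_compact : ∀ X : C,
    (∀ (K : C) (f : K ⟶ X), compactObjects C K → f = 0) → IsZero X
  compact_iff_rigid : ∀ K : C, compactObjects C K ↔ Nonempty (HasRightDual K)

attribute [instance] IsRigidlyCompactlyGenerated.essentiallySmall

end

/-! ### The Balmer spectrum -/

section
variable (C : Type u) [Category.{v} C] [Preadditive C] [HasZeroObject C] [HasShift C ℤ]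
  [∀ n : ℤ, (shiftFunctor C n).Additive] [Pretriangulated C] [MonoidalCategory C]

/-- The points of the Balmer spectrum: the prime thick tensor ideals of the category of compact
objects, regarded as classes of compact objects of `C`. As usual, primes are proper. -/
structure Spc where
  /-- the objects of the prime ideal -/
  carrier : ObjectProperty C
  le_compactObjects : carrier ≤ compactObjects C
  isTriangulated : carrier.IsTriangulated
  isStableUnderRetracts : carrier.IsStableUnderRetracts
  tensor_mem : ∀ K X : C, compactObjects C K → carrier X → carrier (K ⊗ X)
  mem_or_mem : ∀ X Y : C, compactObjects C X → compactObjects C Y →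
    carrier (X ⊗ Y) → carrier X ∨ carrier Y
  proper : ∃ X : C, compactObjects C X ∧ ¬ carrier X

end

namespace Spc
variable {C : Type u} [Category.{v} C] [Preadditive C] [HasZeroObject C] [HasShift C ℤ]
  [∀ n : ℤ, (shiftFunctor C n).Additive] [Pretriangulated C] [MonoidalCategory C]

attribute [instance] Spc.isTriangulated Spc.isStableUnderRetracts

theorem ext_carrier {p q : Spc C} (h : p.carrier = q.carrier) : p = q := by
  cases p; cases q; cases h; rfl

/-- The support `{p | K ∉ p}` of a compact object `K`. -/
def supp (K : C) : Set (Spc C) := {p | ¬ p.carrier K}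

/-- The topology whose closed sets are generated by the supports of the compact objects. -/
instance : TopologicalSpace (Spc C) :=
  TopologicalSpace.generateFrom {U | ∃ K : C, compactObjects C K ∧ U = (supp K)ᶜ}

instance : T0Space (Spc C) where
  t0 p q hpq := by
    refine ext_carrier ?_
    ext K
    by_cases hK : compactObjects C K
    · have ho : IsOpen (supp K : Set (Spc C))ᶜ :=
        TopologicalSpace.isOpen_generateFrom_of_mem ⟨K, hK, rfl⟩
      have := hpq.mem_open_iff ho
      simpa [supp] using this
    · exact iff_of_false (fun h => hK (p.le_compactObjects _ h))
        fun h => hK (q.le_compactObjects _ h)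

/-- The specialization order: `q ≤ p` if and only if `q` lies in the closure of `p`. -/
instance : PartialOrder (Spc C) := specializationOrder (Spc C)

theorem le_iff_mem_closure (q p : Spc C) : q ≤ p ↔ q ∈ closure {p} :=
  specializes_iff_mem_closure

instance [ObjectProperty.EssentiallySmall.{v} (compactObjects C)] : Small.{v} (Spc C) := by
  obtain ⟨Q, _, hQ1, hQ2⟩ :=
    ObjectProperty.EssentiallySmall.exists_small_le.{v} (compactObjects C)
  refine small_of_injective (β := Set (Subtype Q)) (f := fun p => {x | p.carrier x.1}) ?_
  intro p q h
  refine ext_carrier ?_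
  ext K
  by_cases hK : compactObjects C K
  · obtain ⟨K', hK', ⟨e⟩⟩ := hQ2 _ hK
    rw [p.carrier.prop_iff_of_iso e, q.carrier.prop_iff_of_iso e]
    exact Set.ext_iff.1 h ⟨K', hK'⟩
  · exact iff_of_false (fun h => hK (p.le_compactObjects _ h))
      fun h => hK (q.le_compactObjects _ h)

/-- `K` is a Koszul object for `p`: a compact object with support the closure of `p`. -/
def IsKoszul (p : Spc C) (K : C) : Prop := compactObjects C K ∧ supp K = closure {p}

end Spc

/-! ### Localizing subcategories, torsion, local and complete objects -/

section
variable {C : Type u} [Category.{v} C] [Preadditive C] [HasZeroObject C] [HasShift C ℤ]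
  [∀ n : ℤ, (shiftFunctor C n).Additive] [Pretriangulated C]

/-- Localizing subcategories: thick subcategories closed under small coproducts. -/
class IsLocalizing (P : ObjectProperty C) : Prop extends
    P.IsTriangulated, P.IsStableUnderRetracts where
  closedUnderCoproducts : ∀ J : Type v, P.IsClosedUnderColimitsOfShape (Discrete J)

attribute [instance] IsLocalizing.closedUnderCoproducts

variable [MonoidalCategory C]

/-- Localizing tensor ideals. -/
class IsLocalizingIdeal (P : ObjectProperty C) : Prop extends IsLocalizing P where
  tensor_mem : ∀ X Y : C, P Y → P (X ⊗ Y)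

/-- The `V`-torsion objects: the localizing tensor ideal generated by the Koszul objects of the
points of `V`. -/
def torsionObjects (V : Set (Spc C)) : ObjectProperty C := fun X =>
  ∀ P : ObjectProperty C, IsLocalizingIdeal P → (∀ p ∈ V, ∀ K, p.IsKoszul K → P K) → P X

/-- The `U`-local objects: the right orthogonal of the torsion objects for the complement
of `U`. -/
def localObjects (U : Set (Spc C)) : ObjectProperty C := (torsionObjects Uᶜ).rightOrthogonal

/-- The `V`-complete objects: the right orthogonal of the local objects for the complement
of `V`. -/
def completeObjects (V : Set (Spc C)) : ObjectProperty C := (localObjects Vᶜ).rightOrthogonal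

end

/-! ### Existence of the torsion, localization and completion functors -/

section
variable {C : Type u} [Category.{v} C] [Preadditive C] [HasZeroObject C] [HasShift C ℤ]
  [∀ n : ℤ, (shiftFunctor C n).Additive] [Pretriangulated C]

section
variable {X Y Z : C} {f : X ⟶ Y} {g : Y ⟶ Z} {h : Z ⟶ X⟦(1 : ℤ)⟧}

theorem comp₁₂ (hT : Triangle.mk f g h ∈ distTriang C) : f ≫ g = 0 :=
  comp_distTriang_mor_zero₁₂ _ hT

theorem comp₃₁ (hT : Triangle.mk f g h ∈ distTriang C) : h ≫ f⟦(1 : ℤ)⟧' = 0 :=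
  comp_distTriang_mor_zero₃₁ _ hT

theorem exact₂ (hT : Triangle.mk f g h ∈ distTriang C) {W : C} (k : Y ⟶ W) (hk : f ≫ k = 0) :
    ∃ k' : Z ⟶ W, g ≫ k' = k :=
  (Triangle.yoneda_exact₂ _ hT k hk).imp fun _ h => h.symm

theorem coexact₂ (hT : Triangle.mk f g h ∈ distTriang C) {W : C} (k : W ⟶ Y) (hk : k ≫ g = 0) :
    ∃ k' : W ⟶ X, k' ≫ f = k :=
  (Triangle.coyoneda_exact₂ _ hT k hk).imp fun _ h => h.symm

theorem coexact₃ (hT : Triangle.mk f g h ∈ distTriang C) {W : C} (k : W ⟶ Z) (hk : k ≫ h = 0) :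
    ∃ k' : W ⟶ Y, k' ≫ g = k :=
  (Triangle.coyoneda_exact₃ _ hT k hk).imp fun _ h => h.symm

theorem shift_injective (R : ObjectProperty C) [R.IsStableUnderShift ℤ] {A B : C} (u : A ⟶ B)
    (H : ∀ K, R K → ∀ x : K ⟶ A, x ≫ u = 0 → x = 0) {K : C} (hK : R K)
    (x : K ⟶ A⟦(1 : ℤ)⟧) (hx : x ≫ u⟦(1 : ℤ)⟧' = 0) : x = 0 := by
  let e (A : C) : (K⟦(-1 : ℤ)⟧ ⟶ A) ≃ (K ⟶ A⟦(1 : ℤ)⟧) :=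
    (shiftEquiv C (1 : ℤ)).symm.toAdjunction.homEquiv K A
  have he0 (A : C) : e A 0 = 0 :=
    ((shiftEquiv C (1 : ℤ)).symm.toAdjunction.homEquiv_unit K A 0).trans
      (by rw [Functor.map_zero]; exact comp_zero)
  have hex : (e A).symm x ≫ u = (e B).symm (x ≫ u⟦(1 : ℤ)⟧') :=
    ((shiftEquiv C (1 : ℤ)).symm.toAdjunction.homEquiv_naturality_right_symm x u).symm
  have h1 : (e A).symm x = 0 := by
    refine H _ (R.le_shift (-1) _ hK) _ ?_
    rw [hex, hx, Equiv.symm_apply_eq, he0]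
  rw [← (e A).apply_symm_apply x, h1, he0]

theorem rightOrthogonal_cone (R : ObjectProperty C) [R.IsStableUnderShift ℤ]
    (hT : Triangle.mk f g h ∈ distTriang C) (hinj : ∀ K, R K → ∀ x : K ⟶ X, x ≫ f = 0 → x = 0)
    (hsurj : ∀ K, R K → ∀ y : K ⟶ Y, ∃ x : K ⟶ X, x ≫ f = y) :
    R.rightOrthogonal Z := by
  intro K φ hK
  have h0 : φ ≫ h = 0 := shift_injective R f hinj hK _ (by
    rw [Category.assoc, comp₃₁ hT, comp_zero])
  obtain ⟨ψ, rfl⟩ := coexact₃ hT φ h0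
  obtain ⟨x, rfl⟩ := hsurj K hK ψ
  rw [Category.assoc, comp₁₂ hT, comp_zero]
end

theorem isLocalizing_iInf {ι : Sort*} (P : ι → ObjectProperty C) (h : ∀ i, IsLocalizing (P i)) :
    IsLocalizing (fun X => ∀ i, P i X) :=
  have : ObjectProperty.IsStableUnderRetracts (fun X => ∀ i, P i X) :=
    ⟨fun r hY i => (P i).prop_of_retract r (hY i)⟩
  { exists_zero := ⟨_, isZero_zero C, fun i => (P i).prop_zero⟩
    isStableUnderShiftBy := fun n => ⟨fun _ hX i => (P i).le_shift n _ (hX i)⟩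
    toIsTriangulatedClosed₂ := .mk' fun T hT h₁ h₃ i =>
      (P i).ext_of_isTriangulatedClosed₂ T hT (h₁ i) (h₃ i)
    closedUnderCoproducts := fun _ => ⟨fun _ ⟨c⟩ i =>
      (P i).prop_of_isColimit c.isColimit fun j => c.prop_diag_obj j i⟩ }

theorem isLocalizing_leftOrthogonal (R : ObjectProperty C) [R.IsStableUnderShift ℤ] :
    IsLocalizing R.leftOrthogonal where
  of_retract r h W f hW := by
    have := h (r.r ≫ f) hW
    rw [← Category.id_comp f, ← r.retract, Category.assoc, this, comp_zero]
  closedUnderCoproducts J := ⟨fun X ⟨c⟩ W f hW => by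
    refine c.isColimit.hom_ext fun j => ?_
    rw [comp_zero]
    exact c.prop_diag_obj j _ hW⟩

theorem isLocalizing_inverseImage (P : ObjectProperty C) [IsLocalizing P] (F : C ⥤ C)
    [F.CommShift ℤ] [F.IsTriangulated]
    [∀ J : Type v, PreservesColimitsOfShape (Discrete J) F] : IsLocalizing (P.inverseImage F) :=
  have : (P.inverseImage F).IsStableUnderRetracts :=
    ⟨fun r hY => P.prop_of_retract (r.map F) hY⟩
  { exists_zero := ⟨_, isZero_zero C, P.prop_of_isZero (F.map_isZero (isZero_zero C))⟩
    isStableUnderShiftBy := fun n => ⟨fun X hX =>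
      P.prop_of_iso ((F.commShiftIso n).app X).symm (P.le_shift n _ hX)⟩
    toIsTriangulatedClosed₂ := .mk' fun T hT h₁ h₃ =>
      P.ext_of_isTriangulatedClosed₂ _ (F.map_distinguished T hT) h₁ h₃
    closedUnderCoproducts := fun _ => inferInstance }

theorem isLeftAdjoint_ι (P : ObjectProperty C) [P.IsTriangulated]
    (h : ∀ X, ∃ (T Y : C) (f : T ⟶ X) (g : X ⟶ Y) (h : Y ⟶ T⟦(1 : ℤ)⟧),
      Triangle.mk f g h ∈ distTriang C ∧ P T ∧ P.rightOrthogonal Y) : P.ι.IsLeftAdjoint := by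
  choose T Y f g h hT hP hY using h
  have bij (A : P.FullSubcategory) (X : C) : Function.Bijective
      (fun k : A ⟶ (⟨T X, hP X⟩ : P.FullSubcategory) => k.hom ≫ f X) := by
    constructor
    · intro k k' hk
      ext
      rw [← sub_eq_zero]
      have hk' : (k.hom - k'.hom) ≫ f X = 0 := by
        rw [Preadditive.sub_comp, sub_eq_zero]; exact hk
      obtain ⟨l, hl⟩ := coexact₂ (inv_rot_of_distTriang _ (hT X)) (k.hom - k'.hom) hk'
      rw [← hl]
      exact (congrArg (· ≫ _) (P.rightOrthogonal.le_shift (-1) _ (hY X) l A.2)).trans zero_comp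
    · intro k
      obtain ⟨l, hl⟩ := coexact₂ (hT X) k (hY X _ A.2)
      exact ⟨ObjectProperty.homMk l, hl⟩
  exact ⟨_, ⟨Adjunction.adjunctionOfEquivRight
    (fun A X => (Equiv.ofBijective _ (bij A X)).symm) (fun A' A X k l => by
      rw [Equiv.symm_apply_eq]
      exact congrArg (k.hom ≫ ·) ((Equiv.ofBijective _ (bij A X)).apply_symm_apply l).symm |>.trans
        (Category.assoc _ _ _).symm)⟩⟩

theorem isRightAdjoint_ι (P : ObjectProperty C) [P.IsTriangulated]
    (h : ∀ X, ∃ (T Y : C) (f : T ⟶ X) (g : X ⟶ Y) (h : Y ⟶ T⟦(1 : ℤ)⟧),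
      Triangle.mk f g h ∈ distTriang C ∧ P T ∧ P.rightOrthogonal Y) :
    P.rightOrthogonal.ι.IsRightAdjoint := by
  choose T Y f g h hT hP hY using h
  have bij (X : C) (A : P.rightOrthogonal.FullSubcategory) : Function.Bijective
      (fun k : (⟨Y X, hY X⟩ : P.rightOrthogonal.FullSubcategory) ⟶ A => g X ≫ k.hom) := by
    constructor
    · intro k k' hk
      ext
      rw [← sub_eq_zero]
      have hk' : g X ≫ (k.hom - k'.hom) = 0 := by
        rw [Preadditive.comp_sub, sub_eq_zero]; exact hk
      obtain ⟨l, hl⟩ := exact₂ (rot_of_distTriang _ (hT X)) (k.hom - k'.hom) hk'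
      rw [← hl]
      exact (congrArg (_ ≫ ·) (A.2 l (P.le_shift 1 _ (hP X)))).trans comp_zero
    · intro k
      obtain ⟨l, hl⟩ := exact₂ (hT X) k (A.2 _ (hP X))
      exact ⟨ObjectProperty.homMk l, hl⟩
  exact ⟨_, ⟨Adjunction.adjunctionOfEquivLeft
    (fun X A => Equiv.ofBijective _ (bij X A)) (fun X A A' k l => by
      simp)⟩⟩

end

section
variable {C : Type u} [Category.{v} C] [Preadditive C] [HasCoproducts.{v} C]

theorem compactObjects.exists_eq_sum {K : C} (hK : compactObjects C K) {J : Type v} (Y : J → C)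
    (h : K ⟶ ∐ Y) : ∃ (s : Finset J) (a : ∀ j, K ⟶ Y j), h = ∑ j ∈ s, a j ≫ Sigma.ι Y j := by
  classical
  have := hK J
  let F := preadditiveCoyoneda.obj (op K)
  have hc := isColimitOfPreserves F (colimit.isColimit (Discrete.functor Y))
  let φ : (DirectSum J fun j => (K ⟶ Y j)) →+ (K ⟶ ∐ Y) :=
    DirectSum.toAddMonoid fun j => Preadditive.rightComp K (Sigma.ι Y j)
  let q : AddCommGrpCat.of (K ⟶ ∐ Y) ⟶ AddCommGrpCat.of ((K ⟶ ∐ Y) ⧸ φ.range) :=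
    AddCommGrpCat.ofHom (QuotientAddGroup.mk' φ.range)
  have hq : q = 0 := by
    refine hc.hom_ext (fun j => ?_)
    ext (x : K ⟶ Y j.as)
    change ((x ≫ Sigma.ι Y j.as : K ⟶ ∐ Y) : (K ⟶ ∐ Y) ⧸ φ.range) = 0
    rw [QuotientAddGroup.eq_zero_iff]
    refine ⟨DirectSum.of _ j.as x, ?_⟩
    rw [DirectSum.toAddMonoid_of]
    rfl
  have h0 : (h : (K ⟶ ∐ Y) ⧸ φ.range) = 0 := ConcreteCategory.congr_hom hq h
  rw [QuotientAddGroup.eq_zero_iff] at h0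
  obtain ⟨x, rfl⟩ := h0
  refine ⟨DFinsupp.support x, fun j => x j, ?_⟩
  simp only [φ]
  conv_lhs => rw [← DirectSum.sum_support_of x]
  simp only [map_sum, DirectSum.toAddMonoid_of]
  rfl

theorem compactObjects.of_natIso {K K' : C} (F : C ⥤ C) (hK : compactObjects C K)
    [hF : ∀ J : Type v, PreservesColimitsOfShape (Discrete J) F]
    (e : F ⋙ preadditiveCoyoneda.obj (op K) ≅ preadditiveCoyoneda.obj (op K')) :
    compactObjects C K' := fun J => by
  have := hK J
  exact preservesColimitsOfShape_of_natIso e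

instance : (compactObjects C).IsClosedUnderIsomorphisms where
  of_iso e h := h.of_natIso (𝟭 C) (Functor.leftUnitor _ ≪≫ preadditiveCoyoneda.mapIso e.symm.op)
end

section
variable {C : Type u} [Category.{v} C] [Preadditive C] [HasZeroObject C] [HasShift C ℤ]
  [∀ n : ℤ, (shiftFunctor C n).Additive] [Pretriangulated C] [HasCoproducts.{v} C]

theorem compactObjects.exists_eq_sum_nat {K : C} (hK : compactObjects C K) (Y : ℕ → C)
    (h : K ⟶ ∐ Y) : ∃ (s : Finset ℕ) (a : ∀ j, K ⟶ Y j), h = ∑ j ∈ s, a j ≫ Sigma.ι Y j := by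
  classical
  let Y' : ULift.{v} ℕ → C := fun n => Y n.down
  let e : ∐ Y ≅ ∐ Y' := Sigma.whiskerEquiv (f := Y) (g := Y') Equiv.ulift.symm (fun j => Iso.refl (Y j))
  obtain ⟨s, a, hs⟩ := hK.exists_eq_sum Y' (h ≫ e.hom)
  refine ⟨s.map Equiv.ulift.toEmbedding, fun j => a ⟨j⟩, ?_⟩
  rw [← cancel_mono e.hom, hs, Preadditive.sum_comp, Finset.sum_map]
  refine Finset.sum_congr rfl fun j _ => ?_
  obtain ⟨j⟩ := j
  simp only [Category.assoc]
  have : Sigma.ι Y j ≫ e.hom = Sigma.ι Y' ⟨j⟩ := by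
    refine (Sigma.ι_comp_map' (f := Y) (g := Y') _ _ j).trans ?_
    exact Category.id_comp _
  exact (congrArg (a ⟨j⟩ ≫ ·) this).symm

/-- The map `1 - shift` whose cone is the sequential homotopy colimit. -/
noncomputable def telescope {Y : ℕ → C} (t : ∀ n, Y n ⟶ Y (n + 1)) : ∐ Y ⟶ ∐ Y :=
  Sigma.desc fun n => Sigma.ι Y n - t n ≫ Sigma.ι Y (n + 1)

theorem telescope_injective {K : C} (hK : compactObjects C K) {Y : ℕ → C}
    (t : ∀ n, Y n ⟶ Y (n + 1)) (h : K ⟶ ∐ Y) (h0 : h ≫ telescope t = 0) : h = 0 := by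
  classical
  obtain ⟨s, a, rfl⟩ := hK.exists_eq_sum_nat Y h
  let p (m : ℕ) : ∐ Y ⟶ Y m := Sigma.desc fun i => if e : i = m then eqToHom (by rw [e]) else 0
  have hp (i m : ℕ) : Sigma.ι Y i ≫ p m = if e : i = m then eqToHom (by rw [e]) else 0 := by
    simp [p]
  have h0' : telescope t ≫ p 0 = p 0 := by
    refine Sigma.hom_ext _ _ fun i => ?_
    simp [telescope, Preadditive.sub_comp, hp]
  have h1' (m : ℕ) : telescope t ≫ p (m + 1) = p (m + 1) - p m ≫ t m := by
    refine Sigma.hom_ext _ _ fun i => ?_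
    simp only [telescope, colimit.ι_desc_assoc, Cofan.mk_pt, Cofan.mk_ι_app, Preadditive.sub_comp,
      Preadditive.comp_sub, Category.assoc, hp, ← Category.assoc (Sigma.ι Y i) (p m)]
    congr 1
    by_cases e : i = m
    · subst e; simp
    · simp [e]
  set h := ∑ j ∈ s, a j ≫ Sigma.ι Y j with hh
  have key (m : ℕ) : h ≫ p m = 0 := by
    induction m with
    | zero => rw [← h0', ← Category.assoc, h0, zero_comp]
    | succ m ih =>
      have := h ≫= h1' m
      rw [← Category.assoc, h0, zero_comp, Preadditive.comp_sub, ← Category.assoc h (p m), ih,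
        zero_comp, sub_zero] at this
      exact this.symm
  have key2 (m : ℕ) (hm : m ∈ s) : a m = 0 := by
    have := key m
    rw [hh, Preadditive.sum_comp, Finset.sum_eq_single m] at this
    · simpa [hp] using this
    · intro b _ hb
      simp [hp, hb]
    · exact fun h => (h hm).elim
  exact Finset.sum_eq_zero fun j hj => by rw [key2 j hj, zero_comp]

instance : (compactObjects C).IsStableUnderShift ℤ where
  isStableUnderShiftBy n := ⟨fun K hK => by
    have : (shiftEquiv C n).functor.Additive := inferInstanceAs (shiftFunctor C n).Additive
    refine hK.of_natIso (shiftFunctor C (-n)) (K' := K⟦n⟧) ?_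
    refine NatIso.ofComponents (fun Y => AddEquiv.toAddCommGrpIso 
      (X := AddCommGrpCat.of (K ⟶ Y⟦-n⟧)) (Y := AddCommGrpCat.of (K⟦n⟧ ⟶ Y))
      (AddEquiv.symm ((shiftEquiv C n).toAdjunction.homAddEquiv K Y))) ?_
    intro Y Z f
    ext (g : K ⟶ Y⟦-n⟧)
    change ((shiftEquiv C n).toAdjunction.homEquiv K Z).symm (g ≫ f⟦-n⟧') = 
      ((shiftEquiv C n).toAdjunction.homEquiv K Y).symm g ≫ f
    exact Adjunction.homEquiv_naturality_right_symm _ _ _⟩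

/-- Colocalization triangles for localizing subcategories, with respect to compact objects. -/
theorem exists_triangle [ObjectProperty.EssentiallySmall.{v} (compactObjects C)]
    (P : ObjectProperty C) [P.IsTriangulated] [P.IsClosedUnderIsomorphisms]
    [∀ J : Type v, P.IsClosedUnderColimitsOfShape (Discrete J)] (X : C) :
    ∃ (T Y : C) (f : T ⟶ X) (g : X ⟶ Y) (h : Y ⟶ T⟦(1 : ℤ)⟧), Triangle.mk f g h ∈ distTriang C ∧
      P T ∧ (P ⊓ compactObjects C).rightOrthogonal Y := by
  have : ObjectProperty.EssentiallySmall.{v} (P ⊓ compactObjects C) :=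
    ObjectProperty.EssentiallySmall.of_le inf_le_right
  obtain ⟨Q, _, hQ1, hQ2⟩ :=
    ObjectProperty.EssentiallySmall.exists_small_le.{v} (P ⊓ compactObjects C)
  let S : Shrink.{v} (Subtype Q) → C := fun i => ((equivShrink _).symm i).1
  have hS (i) : (P ⊓ compactObjects C) (S i) := hQ1 _ ((equivShrink _).symm i).2
  have hQS {K : C} (hK : (P ⊓ compactObjects C) K) : ∃ i, Nonempty (K ≅ S i) := by
    obtain ⟨K', hK', ⟨e⟩⟩ := hQ2 _ hK
    exact ⟨equivShrink _ ⟨K', hK'⟩, ⟨e ≪≫ eqToIso (by simp [S])⟩⟩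
  have step (A : {A : Over X // P A.left}) : ∃ (B : {A : Over X // P A.left}) (k : A.1 ⟶ B.1),
      ∀ i (f : S i ⟶ A.1.left), f ≫ A.1.hom = 0 → f ≫ k.left = 0 := by
    let J := Σ i, {f : S i ⟶ A.1.left // f ≫ A.1.hom = 0}
    let w : (∐ fun j : J => S j.1) ⟶ A.1.left := Sigma.desc fun j => j.2.1
    obtain ⟨Z, b, c, hT⟩ := distinguished_cocone_triangle w
    have hw : w ≫ A.1.hom = 0 := Sigma.hom_ext _ _ fun j => by simpa [w] using j.2.2
    obtain ⟨t, ht⟩ := exact₂ hT A.1.hom hw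
    have hZ : P Z := P.ext_of_isTriangulatedClosed₃ _ hT
      (P.prop_colimit _ fun j => (hS _).1) A.2
    refine ⟨⟨Over.mk t, hZ⟩, Over.homMk b ht, fun i f hf => ?_⟩
    have : f = Sigma.ι (fun j : J => S j.1) ⟨i, f, hf⟩ ≫ w := by simp [w]
    rw [this, Category.assoc]
    exact (congrArg _ (comp₁₂ hT)).trans comp_zero
  choose next k hk using step
  let A0 : {A : Over X // P A.left} := ⟨Over.mk (Sigma.desc fun j : Σ i, (S i ⟶ X) => j.2),
    P.prop_colimit _ fun j => (hS _).1⟩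
  let A : ℕ → {A : Over X // P A.left} := fun n => Nat.rec A0 (fun _ => next) n
  let t (n) : (A n).1.left ⟶ (A (n + 1)).1.left := (k (A n)).left
  have ht (n) : t n ≫ (A (n + 1)).1.hom = (A n).1.hom := Over.w (k (A n))
  have hkt (n i) (f : S i ⟶ (A n).1.left) (hf : f ≫ (A n).1.hom = 0) : f ≫ t n = 0 :=
    hk (A n) i f hf
  let Y (n) : C := (A n).1.left
  obtain ⟨T, p, q, hT⟩ := distinguished_cocone_triangle (telescope (Y := Y) t)
  have hPY : P (∐ Y) := by
    have : P.IsClosedUnderColimitsOfShape (Discrete ℕ) :=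
      .of_equivalence (Discrete.equivalence (Equiv.ulift.{v} : _ ≃ ℕ))
    exact P.prop_colimit _ fun n => (A _).2
  have hPT : P T := P.ext_of_isTriangulatedClosed₃ _ hT hPY hPY
  have htel : telescope (Y := Y) t ≫ Sigma.desc (fun n => (A n).1.hom) = 0 := by
    refine Sigma.hom_ext _ _ fun n => ?_
    simp [telescope, Preadditive.sub_comp, Y, ht]
  obtain ⟨f, hf⟩ := exact₂ hT _ htel
  replace hf (n) : (Sigma.ι Y n ≫ p) ≫ f = (A n).1.hom := by
    rw [Category.assoc]
    rw [hf]; simp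
  have hp (n) : Sigma.ι Y n ≫ p = t n ≫ Sigma.ι Y (n + 1) ≫ p := by
    have : Sigma.ι Y n ≫ telescope (Y := Y) t ≫ p = 0 := by
      rw [comp₁₂ hT, comp_zero]
    simpa [telescope, Preadditive.sub_comp, sub_eq_zero] using this
  -- every map from a compact object of `P` factors through a stage
  have hfac {K : C} (hK : (P ⊓ compactObjects C) K) (x : K ⟶ T) :
      ∃ n, ∃ y : K ⟶ Y n, x = y ≫ Sigma.ι Y n ≫ p := by
    have hx : x ≫ q = 0 := by
      refine shift_injective (compactObjects C) (telescope (Y := Y) t)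
        (fun K hK h => telescope_injective hK (Y := Y) t h) hK.2 _ ?_
      rw [Category.assoc, comp₃₁ hT, comp_zero]
    obtain ⟨y, rfl⟩ := coexact₃ hT x hx
    obtain ⟨s, a, rfl⟩ := hK.2.exists_eq_sum_nat Y y
    have push (n N : ℕ) (hn : n ≤ N) (a : K ⟶ Y n) :
        ∃ b : K ⟶ Y N, a ≫ Sigma.ι Y n ≫ p = b ≫ Sigma.ι Y N ≫ p := by
      induction N, hn using Nat.le_induction with
      | base => exact ⟨a, rfl⟩
      | succ N _ ih =>
        obtain ⟨b, hb⟩ := ih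
        exact ⟨b ≫ t N, by rw [hb, hp, Category.assoc]⟩
    have hle (j) (hj : j ∈ s) : j ≤ s.sup id := Finset.le_sup (f := id) hj
    choose! b hb using fun j hj => push j (s.sup id) (hle j hj) (a j)
    refine ⟨s.sup id, ∑ j ∈ s, b j, ?_⟩
    rw [Preadditive.sum_comp, Preadditive.sum_comp]
    simp only [Category.assoc]
    exact Finset.sum_congr rfl hb
  obtain ⟨Z, g, h, hT'⟩ := distinguished_cocone_triangle f
  refine ⟨T, Z, f, g, h, hT', hPT, rightOrthogonal_cone _ hT' ?_ ?_⟩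
  · intro K hK x hx
    obtain ⟨n, y, rfl⟩ := hfac hK x
    obtain ⟨i, ⟨e⟩⟩ := hQS hK
    replace hx : y ≫ (A n).1.hom = 0 := by
      rw [← hf n]
      simpa only [Category.assoc] using hx
    have := hkt n i (e.inv ≫ y) (by rw [Category.assoc, hx, comp_zero])
    rw [Category.assoc] at this
    have hy : y ≫ t n = 0 := by rw [← cancel_epi e.inv, this, comp_zero]
    rw [hp, ← Category.assoc, hy, zero_comp]
  · intro K hK y
    obtain ⟨i, ⟨e⟩⟩ := hQS hK
    refine ⟨e.hom ≫ Sigma.ι (fun j : Σ i, (S i ⟶ X) => S j.1) ⟨i, e.inv ≫ y⟩ ≫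
      Sigma.ι Y 0 ≫ p, ?_⟩
    have := hf 0
    simp only [Category.assoc] at this
    simp only [Category.assoc, this]
    simp [A, A0]

end

section
variable {C : Type u} [Category.{v} C] [Preadditive C] [HasZeroObject C] [HasShift C ℤ]
  [∀ n : ℤ, (shiftFunctor C n).Additive] [Pretriangulated C]
  [MonoidalCategory C]

instance (V : Set (Spc C)) : IsLocalizingIdeal (torsionObjects V) where
  toIsLocalizing := by
    have := isLocalizing_iInf (C := C) (ι := {P : ObjectProperty C // IsLocalizingIdeal P ∧
      ∀ p ∈ V, ∀ K, p.IsKoszul K → P K}) (fun P => P.1) (fun P => P.2.1.toIsLocalizing)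
    refine (congrArg IsLocalizing ?_).mp this
    ext X
    exact ⟨fun h P h1 h2 => h ⟨P, h1, h2⟩, fun h P => h P.1 P.2.1 P.2.2⟩
  tensor_mem X Y hY P hP h := hP.tensor_mem X Y (hY P hP h)

theorem torsionObjects_of_isKoszul {V : Set (Spc C)} {p : Spc C} (hp : p ∈ V) {K : C}
    (hK : p.IsKoszul K) : torsionObjects V K := fun _ _ h => h p hp K hK

instance (U : Set (Spc C)) : (localObjects U).IsTriangulated :=
  inferInstanceAs (torsionObjects Uᶜ).rightOrthogonal.IsTriangulated

instance (U : Set (Spc C)) : (localObjects U).IsClosedUnderIsomorphisms :=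
  inferInstanceAs (torsionObjects Uᶜ).rightOrthogonal.IsClosedUnderIsomorphisms

variable [HasCoproducts.{v} C] [SymmetricCategory C] [MonoidalClosed C]
  [∀ X : C, (tensorLeft X).CommShift ℤ] [∀ X : C, (tensorLeft X).IsTriangulated]
  [IsRigidlyCompactlyGenerated C]

theorem of_compact (P : ObjectProperty C) [IsLocalizing P] (h : compactObjects C ≤ P) (X : C) :
    P X := by
  obtain ⟨T, Y, f, g, k, hT, hP, hY⟩ := exists_triangle P X
  have hY0 : IsZero Y := IsRigidlyCompactlyGenerated.isZero_of_forall_compact Y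
    fun K f hK => hY f ⟨h _ hK, hK⟩
  have : IsIso f := (Triangle.isZero₃_iff_isIso₁ _ hT).1 hY0
  exact P.prop_of_iso (asIso f) hP

theorem exists_dual {K : C} (hK : compactObjects C K) :
    ∃ K' : C, compactObjects C K' ∧ Nonempty (ExactPairing K K') := by
  obtain ⟨h⟩ := (IsRigidlyCompactlyGenerated.compact_iff_rigid K).1 hK
  let := BraidedCategory.exactPairing_swap K Kᘁ
  exact ⟨Kᘁ, (IsRigidlyCompactlyGenerated.compact_iff_rigid _).2 ⟨⟨K⟩⟩, ⟨inferInstance⟩⟩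

theorem compact_tensor {K L : C} (hK : compactObjects C K) (hL : compactObjects C L) :
    compactObjects C (K ⊗ L) := by
  obtain ⟨K', -, ⟨_⟩⟩ := exists_dual hK
  obtain ⟨L', -, ⟨_⟩⟩ := exists_dual hL
  exact (IsRigidlyCompactlyGenerated.compact_iff_rigid _).2 ⟨⟨L' ⊗ K'⟩⟩

theorem localObjects_of_compact {U : Set (Spc C)} {Y : C}
    (hY : (torsionObjects Uᶜ ⊓ compactObjects C).rightOrthogonal Y) : localObjects U Y := by
  let R : ObjectProperty C := fun A => ∃ n : ℤ, Nonempty (A ≅ Y⟦n⟧)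
  have : R.IsStableUnderShift ℤ := ⟨fun n => ⟨fun A ⟨m, ⟨e⟩⟩ =>
    ⟨m + n, ⟨(shiftFunctor C n).mapIso e ≪≫ ((shiftFunctorAdd C m n).app Y).symm⟩⟩⟩⟩
  let O := R.leftOrthogonal
  have : IsLocalizing O := isLocalizing_leftOrthogonal R
  let I : ObjectProperty C := fun X => ∀ W : C, O.inverseImage (tensorLeft W) X
  have hI : IsLocalizing I := isLocalizing_iInf _ fun W => isLocalizing_inverseImage O _
  have hI' : IsLocalizingIdeal I :=
    { tensor_mem := fun X Z hZ W => O.prop_of_iso (α_ W X Z) (hZ (W ⊗ X)) }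
  have hTI : ∀ X, torsionObjects Uᶜ X → I X := fun X hX => hX I hI' fun p hp K hK W => by
    have := isLocalizing_inverseImage O (tensorLeft K)
    refine O.prop_of_iso (β_ K W) (of_compact (O.inverseImage (tensorLeft K)) ?_ W)
    rintro L hL A f ⟨n, ⟨e⟩⟩
    rw [← cancel_mono e.hom, zero_comp]
    refine (torsionObjects Uᶜ ⊓ compactObjects C).rightOrthogonal.le_shift n _ hY _ ⟨?_, ?_⟩
    · exact (torsionObjects Uᶜ).prop_of_iso (β_ L K)
        (IsLocalizingIdeal.tensor_mem _ _ (torsionObjects_of_isKoszul hp hK))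
    · exact compact_tensor hK.1 hL
  intro X f hX
  have := hTI X hX (𝟙_ C) ((λ_ X).hom ≫ f) ⟨0, ⟨((shiftFunctorZero C ℤ).app Y).symm⟩⟩
  rwa [← cancel_epi (λ_ X).hom, comp_zero]

theorem exists_torsion_triangle (U : Set (Spc C)) (X : C) :
    ∃ (T Y : C) (f : T ⟶ X) (g : X ⟶ Y) (h : Y ⟶ T⟦(1 : ℤ)⟧), Triangle.mk f g h ∈ distTriang C ∧
      torsionObjects Uᶜ T ∧ localObjects U Y := by
  obtain ⟨T, Y, f, g, h, hT, hP, hY⟩ := exists_triangle (torsionObjects Uᶜ) X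
  exact ⟨T, Y, f, g, h, hT, hP, localObjects_of_compact hY⟩

instance (U : Set (Spc C)) : IsLocalizing (localObjects U) where
  of_retract r h W f hW := by
    have := h (f ≫ r.i) hW
    rw [← Category.comp_id f, ← r.retract, ← Category.assoc, this, zero_comp]
  closedUnderCoproducts J := ⟨fun X ⟨c⟩ => localObjects_of_compact fun K f hK => by
    let Y : J → C := fun j => c.diag.obj ⟨j⟩
    let e : ∐ Y ≅ X := (colimit.isColimit (Discrete.functor Y)).coconePointsIsoOfNatIso
      c.isColimit (Discrete.natIso fun _ => Iso.refl _)
    obtain ⟨s, a, hs⟩ := hK.2.exists_eq_sum Y (f ≫ e.inv)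
    rw [← cancel_mono e.inv, hs, zero_comp]
    exact Finset.sum_eq_zero fun j _ => by rw [c.prop_diag_obj ⟨j⟩ (a j) hK.1, zero_comp]⟩

theorem localObjects_tensor (U : Set (Spc C)) {Y : C} (hY : localObjects U Y) (W : C) :
    localObjects U (W ⊗ Y) := by
  have := isLocalizing_inverseImage (localObjects U) (tensorLeft Y)
  refine (localObjects U).prop_of_iso (β_ Y W)
    (of_compact ((localObjects U).inverseImage (tensorLeft Y)) ?_ W)
  intro K hK
  refine (localObjects U).prop_of_iso (β_ K Y) ?_
  obtain ⟨K', -, ⟨_⟩⟩ := exists_dual hK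
  intro X f hX
  apply (tensorLeftHomEquiv X K K' Y).symm.injective
  exact (hY _ (IsLocalizingIdeal.tensor_mem K' X hX)).trans
    (hY _ (IsLocalizingIdeal.tensor_mem K' X hX)).symm

theorem isZero_tensor {U : Set (Spc C)} {T Y : C} (hT : torsionObjects Uᶜ T)
    (hY : localObjects U Y) : IsZero (Y ⊗ T) := by
  exact (IsZero.iff_id_eq_zero (Y ⊗ T)).2 <| (localObjects U).prop_of_iso (β_ T Y) (localObjects_tensor U hY T) _
    (IsLocalizingIdeal.tensor_mem Y T hT)

theorem exists_completion_triangle (V : Set (Spc C)) (X : C) :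
    ∃ (D Z : C) (f : D ⟶ X) (g : X ⟶ Z) (h : Z ⟶ D⟦(1 : ℤ)⟧), Triangle.mk f g h ∈ distTriang C ∧
      localObjects Vᶜ D ∧ completeObjects V Z := by
  obtain ⟨T, L, t, l, k, hT, htors, hloc⟩ := exists_torsion_triangle Vᶜ (𝟙_ C)
  let Z := (ihom T).obj X
  let g : X ⟶ Z := MonoidalClosed.curry (t ▷ X ≫ (λ_ X).hom)
  obtain ⟨D, f, h, hD⟩ := distinguished_cocone_triangle₁ g
  have hiso (A : C) (hA : torsionObjects Vᶜᶜ A) : IsIso (t ▷ A) := by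
    have h1 : IsIso (A ◁ t) :=
      (Triangle.isZero₃_iff_isIso₁ _ ((tensorLeft A).map_distinguished _ hT)).1
        ((isZero_tensor hA hloc).of_iso (β_ A L))
    have : t ▷ A = (β_ T A).hom ≫ A ◁ t ≫ (β_ (𝟙_ C) A).inv := by
      rw [← BraidedCategory.braiding_naturality_left_assoc, Iso.hom_inv_id, Category.comp_id]
    rw [this]
    infer_instance
  have hcomp (A : C) (a : A ⟶ X) : a ≫ g = MonoidalClosed.curry (t ▷ A ≫ (λ_ A).hom ≫ a) := by
    rw [← MonoidalClosed.curry_natural_left]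
    congr 1
    rw [← Category.assoc, MonoidalCategory.whisker_exchange, Category.assoc,
      leftUnitor_naturality]
  have huncurry (A : C) : MonoidalClosed.uncurry (0 : A ⟶ Z) = 0 := by
    rw [MonoidalClosed.uncurry_eq]
    exact (congrArg (· ≫ _) ((tensorLeft T).map_zero A Z)).trans zero_comp
  refine ⟨D, Z, f, g, h, hD, ?_, ?_⟩
  · have key : (torsionObjects Vᶜᶜ).rightOrthogonal (D⟦(1 : ℤ)⟧) := by
      refine rightOrthogonal_cone _ (rot_of_distTriang _ hD) ?_ ?_
      · intro A hA a ha
        have := hiso A hA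
        replace ha := (hcomp A a).symm.trans ha
        have h0 : t ▷ A ≫ (λ_ A).hom ≫ a = 0 := by
          rw [← MonoidalClosed.uncurry_curry (t ▷ A ≫ (λ_ A).hom ≫ a)]
          exact (congrArg MonoidalClosed.uncurry ha).trans (huncurry A)
        refine (cancel_epi (λ_ A).hom).1 ((cancel_epi (t ▷ A)).1 ?_)
        exact h0.trans (by rw [comp_zero, comp_zero])
      · intro A hA (b : A ⟶ Z)
        have := hiso A hA
        refine ⟨(λ_ A).inv ≫ inv (t ▷ A) ≫ MonoidalClosed.uncurry b, (hcomp A _).trans ?_⟩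
        have hb (c : T ⊗ A ⟶ X) :
            t ▷ A ≫ (λ_ A).hom ≫ (λ_ A).inv ≫ inv (t ▷ A) ≫ c = c := by simp
        exact (congrArg MonoidalClosed.curry (hb _)).trans (MonoidalClosed.curry_uncurry b)
    have := (torsionObjects Vᶜᶜ).rightOrthogonal.le_shift (-1) _ key
    exact (localObjects Vᶜ).prop_of_iso ((shiftEquiv C (1 : ℤ)).unitIso.app D).symm this
  · intro A a hA
    apply MonoidalClosed.uncurry_injective
    exact ((isZero_tensor htors hA).of_iso (β_ T A)).eq_of_src _ _

instance (V : Set (Spc C)) : (torsionObjects V).ι.IsLeftAdjoint :=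
  isLeftAdjoint_ι _ fun X => by
    have := exists_torsion_triangle Vᶜ X
    simpa only [localObjects, compl_compl] using this

instance (U : Set (Spc C)) : (localObjects U).ι.IsRightAdjoint :=
  isRightAdjoint_ι _ (exists_torsion_triangle U)

instance (V : Set (Spc C)) : (completeObjects V).ι.IsRightAdjoint :=
  isRightAdjoint_ι _ (exists_completion_triangle V)

/-- The torsion functor `Γ_V`, as an endofunctor of `C`. -/
noncomputable def torsion (V : Set (Spc C)) : C ⥤ C :=
  (torsionObjects V).ι.rightAdjoint ⋙ (torsionObjects V).ι

/-- The localization functor `L_U`, as an endofunctor of `C`. -/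
noncomputable def localization (U : Set (Spc C)) : C ⥤ C :=
  (localObjects U).ι.leftAdjoint ⋙ (localObjects U).ι

/-- The completion functor `Λ_V`, as an endofunctor of `C`. -/
noncomputable def completion (V : Set (Spc C)) : C ⥤ C :=
  (completeObjects V).ι.leftAdjoint ⋙ (completeObjects V).ι

variable (C) in
/-- `Γ_{≤ i}`. The dimension of a prime is its height in the specialization order. -/
noncomputable def torsionLE (i : ℕ) : C ⥤ C := torsion {p | Order.height p ≤ i}

variable (C) in
/-- `L_{≥ i}`. -/
noncomputable def localizationGE (i : ℕ) : C ⥤ C := localization {p | i ≤ Order.height p}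

variable (C) in
/-- The object `E_i = Γ_{≤ i} L_{≥ i} 𝟙`. -/
noncomputable def E (i : ℕ) : C := (torsionLE C i).obj ((localizationGE C i).obj (𝟙_ C))

end

/-! ### Assembly data -/

/-- Assembly data: a subposet of the Balmer spectrum with a poset retraction onto it that
preserves dimensions (heights). -/
structure AssemblyData (C : Type u) [Category.{v} C] [Preadditive C] [HasZeroObject C]
    [HasShift C ℤ] [∀ n : ℤ, (shiftFunctor C n).Additive] [Pretriangulated C]
    [MonoidalCategory C] where
  /-- the subposet, with the induced order -/
  carrier : Set (Spc C)
  /-- the retraction -/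
  α : Spc C →o carrier
  α_eq_self : ∀ x : carrier, α x = x
  height_α : ∀ p : Spc C, Order.height (α p) = Order.height p

namespace AssemblyData

section
variable {C : Type u} [Category.{v} C] [Preadditive C] [HasZeroObject C] [HasShift C ℤ]
  [∀ n : ℤ, (shiftFunctor C n).Additive] [Pretriangulated C] [MonoidalCategory C]
  (A : AssemblyData C)

/-- The elements of dimension `i` of the subposet. -/
abbrev OfDim (i : ℕ) : Type u := {x : A.carrier // Order.height x = i}

instance [ObjectProperty.EssentiallySmall.{v} (compactObjects C)] [HasProducts.{v} C] (i : ℕ) :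
    HasProductsOfShape (A.OfDim i) C :=
  hasLimitsOfShape_of_equivalence (Discrete.equivalence (equivShrink.{v} (A.OfDim i)).symm)

end

variable {C : Type u} [Category.{v} C] [Preadditive C] [HasZeroObject C] [HasShift C ℤ]
  [∀ n : ℤ, (shiftFunctor C n).Additive] [Pretriangulated C] [MonoidalCategory C]
  [HasCoproducts.{v} C] [SymmetricCategory C] [MonoidalClosed C]
  [∀ X : C, (tensorLeft X).CommShift ℤ] [∀ X : C, (tensorLeft X).IsTriangulated]
  [IsRigidlyCompactlyGenerated C] (A : AssemblyData C)

/-- The localization functor at an element `x` of the subposet. -/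
noncomputable def localizationAt (x : A.carrier) : C ⥤ C := localization (A.α ⁻¹' Set.Ici x)

/-- The completion functor at an element `x` of the subposet. -/
noncomputable def completionAt (x : A.carrier) : C ⥤ C := completion (A.α ⁻¹' Set.Iic x)

/-- The value of the adelic cube at the subset `{i}`: the product over all `x` of dimension `i`
of the localization at `x` of the completion at `x` of the unit. -/
noncomputable def adelicRing [HasProducts.{v} C] (i : ℕ) : C :=
  ∏ᶜ fun x : A.OfDim i => (A.localizationAt x.1).obj ((A.completionAt x.1).obj (𝟙_ C))

end AssemblyData

end TTGeometry

/-! Write `T` for `Γ_{≤i} 𝟙` and `L` for `L_{≥i} 𝟙`. Torsion is smashing (`nonempty_torsion_iso`),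
so `E_i ⊗ X` is `T ⊗ (X ⊗ L)`, and both claims reduce to one comparison,
`AssemblyData.nonempty_tensor_iso`: given maps `X ⟶ M x` that become invertible after tensoring with
Koszul objects of the primes over `x`, the induced map from `X ⊗ L` to the product of the
localizations of the `M x` becomes invertible after tensoring with `T`. Part (a) takes identities.
Part (b) takes the completion maps of the unit, and the factor `L` is absorbed because the adelic
ring is already `{≥i}`-local.

Since `T` is built from Koszul objects of primes of dimension at most `i`, invertibility can be
tested on such an object `K` (`isIso_whiskerLeft_of_isKoszul`). If the dimension of `p` is below
`i`, both sides vanish after tensoring, because they are `{≥i}`-local. If it equals `i`, put `x = α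
p`. Distinct elements of dimension `i` are incomparable, so `K` kills every factor except the one at
`x`; as `K` is rigid, tensoring with it commutes with the product (`isIso_whiskerLeft_π`). At the
remaining factor both sides are the localization at `x` of `K ⊗ X`. The point is that `K ⊗ X ⊗ L` is
already local at `x`: the only point of dimension at least `i` in the support of `K` is `p` itself
(`localObjects_tensor_of_isKoszul`).

That last step needs a compact object supported in `V` to be `V`-torsion
(`torsionObjects_of_supp_subset`), which rests on two facts of Balmer's theory: primes can be
separated from thick ideals by Zorn's lemma (`IsCompactThickIdeal.exists_prime`), and in a
Noetherian spectrum every point has a Koszul object (`Spc.exists_isKoszul`). -/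

namespace TTGeometry

set_option linter.unusedSectionVars false

/-! ### Compact objects form a thick subcategory -/

section
variable {C : Type u} [Category.{v} C] [Preadditive C] [HasCoproducts.{v} C]

/-- An object is compact if every map from it to a coproduct is a finite sum of maps through the
summands. -/
theorem compactObjects.of_exists_eq_sum {K : C}
    (hK : ∀ (J : Type v) (Y : J → C) (h : K ⟶ ∐ Y),
      ∃ (s : Finset J) (a : ∀ j, K ⟶ Y j), h = ∑ j ∈ s, a j ≫ Sigma.ι Y j) :
    compactObjects C K := fun J => by
  classical
  refine @preservesColimitsOfShape_of_discrete _ _ _ _ _ _ fun Y => ?_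
  refine preservesColimit_of_preserves_colimit_cocone (colimit.isColimit _) ?_
  let F := preadditiveCoyoneda.obj (op K)
  let t (s : Cocone (Discrete.functor Y ⋙ F)) (j : J) : (K ⟶ Y j) →+ s.pt := (s.ι.app ⟨j⟩).hom
  have hfin (s : Cocone (Discrete.functor Y ⋙ F)) (h : K ⟶ ∐ Y) :
      (Function.support fun j => t s j (h ≫ Sigma.π Y j)).Finite := by
    obtain ⟨S, a, rfl⟩ := hK J Y h
    refine S.finite_toSet.subset fun j hj => ?_
    by_contra hjS
    refine hj ?_
    have : (∑ k ∈ S, a k ≫ Sigma.ι Y k) ≫ Sigma.π Y j = 0 := by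
      rw [Preadditive.sum_comp]
      refine Finset.sum_eq_zero fun k hk => ?_
      rw [Category.assoc, Sigma.ι_π_of_ne _ (by rintro rfl; exact hjS hk), comp_zero]
    exact (congrArg _ this).trans (map_zero (t s j))
  -- The descent map adds up the components of `h`, read off by the projections of the coproduct; by
  -- `hfin` only finitely many contribute, so `finsum` is additive here and not its default value.
  let d (s : Cocone (Discrete.functor Y ⋙ F)) : (K ⟶ ∐ Y) →+ s.pt :=
    { toFun h := ∑ᶠ j, t s j (h ≫ Sigma.π Y j)
      map_zero' := by
        refine (finsum_congr fun j => ?_).trans finsum_zero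
        rw [zero_comp]
        exact map_zero (t s j)
      map_add' := fun h h' => by
        rw [← finsum_add_distrib (hfin s h) (hfin s h')]
        refine finsum_congr fun j => ?_
        rw [Preadditive.add_comp]
        exact map_add (t s j) _ _ }
  have hd (s : Cocone (Discrete.functor Y ⋙ F)) (j : J) (x : K ⟶ Y j) :
      d s (x ≫ Sigma.ι Y j) = t s j x := by
    refine (finsum_eq_single _ j fun k hk => ?_).trans ?_
    · rw [Category.assoc, Sigma.ι_π_of_ne _ hk.symm, comp_zero]
      exact map_zero (t s k)
    · simp
  exact
    { desc := fun s => AddCommGrpCat.ofHom (d s)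
      fac := fun s ⟨j⟩ => by
        ext (x : K ⟶ Y j)
        exact hd s j x
      uniq := fun s m hm => by
        ext (h : K ⟶ ∐ Y)
        change m.hom h = d s h
        obtain ⟨S, a, rfl⟩ := hK J Y h
        refine (map_sum m.hom _ _).trans ((map_sum (d s) _ _).trans ?_).symm
        refine Finset.sum_congr rfl fun j _ => (hd s j (a j)).trans ?_
        exact (ConcreteCategory.congr_hom (hm ⟨j⟩) (a j)).symm }

instance : (compactObjects C).IsStableUnderRetracts where
  of_retract {K L} r hL := .of_exists_eq_sum fun J Y h => by
    obtain ⟨s, a, hs⟩ := hL.exists_eq_sum Y (r.r ≫ h)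
    refine ⟨s, fun j => r.i ≫ a j, ?_⟩
    simp only [Category.assoc]
    rw [← Preadditive.comp_sum, ← hs, r.retract_assoc]

end

section
variable {C : Type u} [Category.{v} C] [Preadditive C] [HasZeroObject C] [HasShift C ℤ]
  [∀ n : ℤ, (shiftFunctor C n).Additive] [Pretriangulated C] [HasCoproducts.{v} C]

instance : (compactObjects C).IsTriangulated where
  exists_zero := ⟨_, isZero_zero C, .of_exists_eq_sum fun J Y h =>
    ⟨∅, fun _ => 0, (isZero_zero C).eq_of_src _ _⟩⟩
  toIsTriangulatedClosed₂ := .mk' fun T hT h₁ h₃ => .of_exists_eq_sum fun J Y f => by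
    classical
    obtain ⟨s, a, hs⟩ := h₁.exists_eq_sum Y (T.mor₁ ≫ f)
    obtain ⟨c, hc⟩ : ∃ c : ∀ j, T.obj₂ ⟶ Y j, ∀ j, c j = f ≫ Sigma.π Y j := ⟨_, fun _ => rfl⟩
    -- Subtracting from `f` its components over `s` leaves a map that vanishes on the first vertex,
    -- hence factors through the third, where compactness applies again.
    have h0 : T.mor₁ ≫ (f - ∑ j ∈ s, c j ≫ Sigma.ι Y j) = 0 := by
      rw [Preadditive.comp_sub, Preadditive.comp_sum, sub_eq_zero]
      conv_lhs => rw [hs]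
      refine Finset.sum_congr rfl fun j hj => ?_
      rw [hc, ← Category.assoc, ← Category.assoc, hs, Preadditive.sum_comp,
        Finset.sum_eq_single_of_mem j hj fun k _ hk => by
          rw [Category.assoc, Sigma.ι_π_of_ne _ hk, comp_zero]]
      simp
    obtain ⟨g, hg⟩ := Triangle.yoneda_exact₂ _ hT _ h0
    obtain ⟨s', b, rfl⟩ := h₃.exists_eq_sum Y g
    refine ⟨s ∪ s', fun j => (if j ∈ s then c j else 0) +
      (if j ∈ s' then T.mor₂ ≫ b j else 0), ?_⟩
    rw [sub_eq_iff_eq_add, add_comm] at hg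
    rw [hg]
    simp only [Preadditive.add_comp, Finset.sum_add_distrib, ite_comp, zero_comp,
      Finset.sum_ite_mem, Finset.union_inter_cancel_left, Finset.union_inter_cancel_right,
      Preadditive.comp_sum, Category.assoc]

end

/-- This is a triangle identity of the duality. It makes thick ideals of compact objects radical and
bounds the support of a dual. -/
theorem retract_tensor_dual {C : Type u} [Category.{v} C] [MonoidalCategory C] {K K' : C}
    [ExactPairing K K'] : Nonempty (Retract K ((K ⊗ K') ⊗ K)) :=
  ⟨{ i := (λ_ K).inv ≫ η_ K K' ▷ K
     r := (α_ K K' K).hom ≫ K ◁ ε_ K K' ≫ (ρ_ K).hom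
     retract := by simp [ExactPairing.evaluation_coevaluation_assoc] }⟩

/-! ### Supports and thick tensor ideals of compact objects -/

section
variable {C : Type u} [Category.{v} C] [Preadditive C] [HasZeroObject C] [HasShift C ℤ]
  [∀ n : ℤ, (shiftFunctor C n).Additive] [Pretriangulated C] [MonoidalCategory C]

namespace Spc

theorem mem_supp {p : Spc C} {K : C} : p ∈ supp K ↔ ¬ p.carrier K := Iff.rfl

theorem supp_tensor_subset_right {K : C} (hK : compactObjects C K) (L : C) :
    supp (K ⊗ L) ⊆ supp L := fun p hp hL => hp (p.tensor_mem K L hK hL)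

theorem supp_eq_of_iso {K L : C} (e : K ≅ L) : supp K = supp L := by
  ext p
  rw [mem_supp, mem_supp, p.carrier.prop_iff_of_iso e]

theorem supp_tensor_subset_left [SymmetricCategory C] (K : C) {L : C} (hL : compactObjects C L) :
    supp (K ⊗ L) ⊆ supp K :=
  (supp_eq_of_iso (β_ K L)).trans_subset (supp_tensor_subset_right hL K)

theorem isClosed_supp {K : C} (hK : compactObjects C K) : IsClosed (supp K : Set (Spc C)) :=
  ⟨TopologicalSpace.isOpen_generateFrom_of_mem ⟨K, hK, rfl⟩⟩

end Spc

/-- A thick tensor ideal of the category of compact objects. -/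
structure IsCompactThickIdeal (P : ObjectProperty C) : Prop where
  le_compactObjects : P ≤ compactObjects C
  isTriangulated : P.IsTriangulated
  isStableUnderRetracts : P.IsStableUnderRetracts
  tensor_mem : ∀ K X : C, compactObjects C K → P X → P (K ⊗ X)

theorem IsCompactThickIdeal.sSup_of_isChain {c : Set (ObjectProperty C)} (hc : IsChain (· ≤ ·) c) (hne : c.Nonempty)
    (h : ∀ P ∈ c, IsCompactThickIdeal P) : IsCompactThickIdeal (fun X => ∃ P ∈ c, P X) := by
  have hret : ObjectProperty.IsStableUnderRetracts (fun X : C => ∃ P ∈ c, P X) :=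
    ⟨fun r ⟨P, hP, hX⟩ => ⟨P, hP, (h P hP).isStableUnderRetracts.of_retract r hX⟩⟩
  refine ⟨fun X ⟨P, hP, hX⟩ => (h P hP).le_compactObjects X hX, ?_, hret,
    fun K X hK ⟨P, hP, hX⟩ => ⟨P, hP, (h P hP).tensor_mem K X hK hX⟩⟩
  exact
    { exists_zero := by
        obtain ⟨P, hP⟩ := hne
        have := (h P hP).isTriangulated
        have := (h P hP).isStableUnderRetracts
        exact ⟨_, isZero_zero C, P, hP, P.prop_zero⟩
      isStableUnderShiftBy := fun n => ⟨fun X ⟨P, hP, hX⟩ => by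
        have := (h P hP).isTriangulated
        exact ⟨P, hP, P.le_shift n _ hX⟩⟩
      toIsTriangulatedClosed₂ := .mk' fun T hT ⟨P, hP, hX⟩ ⟨Q, hQ, hY⟩ => by
        obtain ⟨R, hR, hPR, hQR⟩ := hc.directedOn P hP Q hQ
        have := (h R hR).isTriangulated
        have := (h R hR).isStableUnderRetracts
        exact ⟨R, hR, R.ext_of_isTriangulatedClosed₂ T hT (hPR _ hX) (hQR _ hY)⟩ }

end

/-! ### Koszul objects, existence of primes, and compact torsion objects -/

section
variable {C : Type u} [Category.{v} C] [Preadditive C] [HasZeroObject C] [HasShift C ℤ]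
  [∀ n : ℤ, (shiftFunctor C n).Additive] [Pretriangulated C] [MonoidalCategory C]
  [HasCoproducts.{v} C] [SymmetricCategory C] [MonoidalClosed C]
  [∀ X : C, (tensorLeft X).CommShift ℤ] [∀ X : C, (tensorLeft X).IsTriangulated]
  [IsRigidlyCompactlyGenerated C]

/-- In a Noetherian Balmer spectrum, every prime has a Koszul object. -/
theorem Spc.exists_isKoszul [TopologicalSpace.NoetherianSpace (Spc C)] (p : Spc C) :
    ∃ K, p.IsKoszul K := by
  have hwf : WellFoundedLT (TopologicalSpace.Closeds (Spc C)) :=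
    ((TopologicalSpace.noetherianSpace_TFAE (Spc C)).out 0 1).1 ‹_›
  let S : Set (TopologicalSpace.Closeds (Spc C)) :=
    {Z | p ∈ Z ∧ ∃ K, compactObjects C K ∧ supp K = (Z : Set (Spc C))}
  have hS : S.Nonempty := by
    obtain ⟨K, hK, hpK⟩ := p.proper
    exact ⟨⟨supp K, isClosed_supp hK⟩, hpK, K, hK, rfl⟩
  obtain ⟨Z, ⟨hpZ, K, hK, hKZ⟩, hmin⟩ := hwf.wf.has_min S hS
  have hpK : p ∈ supp K := by rw [hKZ]; exact hpZ
  -- `K` was chosen with minimal support among compact objects supported at `p`; otherwise `K ⊗ L`,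
  -- still supported at `p` by primality, would have strictly smaller support.
  have key (L : C) (hL : compactObjects C L) (hpL : p ∈ supp L) : supp K ⊆ supp L := by
    have hpKL : p ∈ supp (K ⊗ L) := fun h => (p.mem_or_mem K L hK hL h).elim hpK hpL
    have hKL := compact_tensor hK hL
    by_contra hc
    refine hmin ⟨supp (K ⊗ L), isClosed_supp hKL⟩ ⟨hpKL, _, hKL, rfl⟩ (lt_of_le_not_ge ?_ ?_)
    · exact (supp_tensor_subset_left K hL).trans hKZ.subset
    · intro h
      exact hc (hKZ.subset.trans (Set.Subset.trans h (supp_tensor_subset_right hK L)))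
  refine ⟨K, hK, Set.Subset.antisymm (fun q hq => ?_)
    (closure_minimal (Set.singleton_subset_iff.2 hpK) (isClosed_supp hK))⟩
  -- Only subbasic neighbourhoods of `q` need testing, and these are the complements of supports.
  rw [← specializes_iff_mem_closure, Specializes, TopologicalSpace.nhds_generateFrom (a := q)]
  refine le_iInf₂ ?_
  rintro _ ⟨hqL, L, hL, rfl⟩
  rw [Filter.le_principal_iff]
  refine (isClosed_supp hL).isOpen_compl.mem_nhds fun hpL => hqL (key L hL hpL hq)

namespace IsCompactThickIdeal

/-- By rigidity `K` is a retract of `K ⊗ K' ⊗ K`, which lies in the ideal generated by `K ⊗ K`. Thus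
ideals are automatically radical, and Zorn's lemma below need only avoid `K`, not all its tensor
powers. -/
theorem of_sq {P : ObjectProperty C} (hP : IsCompactThickIdeal P) {K : C}
    (hK : compactObjects C K) (h : P (K ⊗ K)) : P K := by
  have := hP.isStableUnderRetracts
  obtain ⟨K', hK', ⟨_⟩⟩ := exists_dual hK
  obtain ⟨r⟩ := retract_tensor_dual (K := K) (K' := K')
  refine P.prop_of_retract r (P.prop_of_iso ?_ (hP.tensor_mem K' _ hK' h))
  exact (α_ K' K K).symm ≪≫ whiskerRightIso (β_ K' K) K

/-- The ideal quotient `(P : L)`; it is the enlargement of `P` to which maximality is applied. -/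
theorem colon {P : ObjectProperty C} (hP : IsCompactThickIdeal P) (L : C) :
    IsCompactThickIdeal (fun X => compactObjects C X ∧ P (L ⊗ X)) := by
  have := hP.isStableUnderRetracts
  have := hP.isTriangulated
  have h1 : (P.inverseImage (tensorLeft L)).IsTriangulated := inferInstance
  exact
    { le_compactObjects := fun X hX => hX.1
      isTriangulated := inferInstanceAs
        (compactObjects C ⊓ P.inverseImage (tensorLeft L)).IsTriangulated
      isStableUnderRetracts := ⟨fun r h =>
        ⟨(compactObjects C).prop_of_retract r h.1, P.prop_of_retract (r.map (tensorLeft L)) h.2⟩⟩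
      tensor_mem := fun K X hK hX => ⟨compact_tensor hK hX.1, P.prop_of_iso
        ((α_ K L X).symm ≪≫ whiskerRightIso (β_ K L) X ≪≫ α_ L K X) (hP.tensor_mem K _ hK hX.2)⟩ }

/-- A thick tensor ideal of compact objects that does not contain `K` is contained in a prime
that does not contain `K`. -/
theorem exists_prime {I : ObjectProperty C} (hI : IsCompactThickIdeal I) {K : C}
    (hK : compactObjects C K) (hIK : ¬ I K) : ∃ p : Spc C, I ≤ p.carrier ∧ ¬ p.carrier K := by
  obtain ⟨P, hIP, ⟨hP, hPK⟩, hmax⟩ := zorn_le_nonempty₀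
    {P : ObjectProperty C | IsCompactThickIdeal P ∧ ¬ P K}
    (fun c hc hch P hP => ⟨fun X => ∃ P ∈ c, P X,
      ⟨sSup_of_isChain hch ⟨P, hP⟩ fun Q hQ => (hc hQ).1, fun ⟨Q, hQ, hQK⟩ => (hc hQ).2 hQK⟩,
      fun Q hQ X hX => ⟨Q, hQ, hX⟩⟩) I ⟨hI, hIK⟩
  have : P.IsStableUnderRetracts := hP.isStableUnderRetracts
  -- The ideal `(P : L)` contains `P` and also `X`, so by maximality it cannot avoid `K`.
  have key (L X : C) (hX : compactObjects C X) (hL : compactObjects C L) (hLX : P (L ⊗ X))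
      (hPX : ¬ P X) : P (L ⊗ K) := by
    by_contra hLK
    refine hPX (hmax (y := fun X => compactObjects C X ∧ P (L ⊗ X))
      ⟨hP.colon L, fun h => hLK h.2⟩ (fun Y hY => ?_) X ⟨hX, hLX⟩)
    exact ⟨hP.le_compactObjects Y hY, hP.tensor_mem L Y hL hY⟩
  refine ⟨⟨P, hP.le_compactObjects, hP.isTriangulated, hP.isStableUnderRetracts, hP.tensor_mem,
    fun X Y hX hY hXY => ?_, K, hK, hPK⟩, hIP, hPK⟩
  by_contra! hc
  -- Two uses of `key` trade first `Y` and then `X` for `K`, giving `K ⊗ K` in `P`.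
  have h1 := P.prop_of_iso (β_ X K) (key X Y hY hX hXY hc.2)
  exact hPK (hP.of_sq hK (key K X hX hK h1 hc.1))

end IsCompactThickIdeal

/-- A compact object whose support is contained in `V` is `V`-torsion. -/
theorem torsionObjects_of_supp_subset [TopologicalSpace.NoetherianSpace (Spc C)] {V : Set (Spc C)}
    {K : C} (hK : compactObjects C K) (h : Spc.supp K ⊆ V) : torsionObjects V K := by
  by_contra hc
  have hI : IsCompactThickIdeal (torsionObjects V ⊓ compactObjects C) :=
    { le_compactObjects := inf_le_right
      isTriangulated := inferInstance
      isStableUnderRetracts := ⟨fun r hX =>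
        ⟨(torsionObjects V).prop_of_retract r hX.1, (compactObjects C).prop_of_retract r hX.2⟩⟩
      tensor_mem := fun L X hL hX => ⟨IsLocalizingIdeal.tensor_mem _ _ hX.1, compact_tensor hL hX.2⟩ }
  -- Such a prime lies in the support of `K`, hence in `V`; its Koszul object is then `V`-torsion
  -- and so belongs to `p`, against its own support.
  obtain ⟨p, hp, hpK⟩ := hI.exists_prime hK fun h => hc h.1
  obtain ⟨L, hL⟩ := p.exists_isKoszul
  have : p ∈ Spc.supp L := hL.2 ▸ subset_closure rfl
  exact this (hp L ⟨torsionObjects_of_isKoszul (h hpK) hL, hL.1⟩)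

end

/-! ### Reflections, coreflections and orthogonality -/

section
variable {C : Type u} [Category.{v} C] [Preadditive C] [HasZeroObject C] [HasShift C ℤ]
  [∀ n : ℤ, (shiftFunctor C n).Additive] [Pretriangulated C]

section
variable (P : ObjectProperty C) [P.IsTriangulated] {X Y Y' : C}

theorem trW_precomp_bijective {g : X ⟶ Y} (hg : P.trW g) {Z : C} (hZ : P.rightOrthogonal Z) :
    Function.Bijective fun k : Y ⟶ Z => g ≫ k := by
  rw [← P.isLocal_trW] at hZ
  exact hZ g hg

theorem trW_postcomp_bijective {f : X ⟶ Y} (hf : P.trW f) {A : C} (hA : P.leftOrthogonal A) :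
    Function.Bijective fun k : A ⟶ X => k ≫ f := by
  rw [← P.isColocal_trW] at hA
  exact hA f hf

/-- Both `g` and `g'` are reflections of `X` into the right orthogonal, and reflections are unique.
-/
theorem isIso_of_trW_comp {g : X ⟶ Y} (hg : P.trW g) (hY : P.rightOrthogonal Y) {g' : X ⟶ Y'}
    (hg' : P.trW g') (hY' : P.rightOrthogonal Y') (k : Y ⟶ Y') (hk : g ≫ k = g') : IsIso k := by
  obtain ⟨l, hl : g' ≫ l = g⟩ := (trW_precomp_bijective P hg' hY).2 g
  refine ⟨l, (trW_precomp_bijective P hg hY).1 ?_, (trW_precomp_bijective P hg' hY').1 ?_⟩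
  · change g ≫ k ≫ l = g ≫ 𝟙 Y
    rw [reassoc_of% hk, hl, Category.comp_id]
  · change g' ≫ l ≫ k = g' ≫ 𝟙 Y'
    rw [reassoc_of% hl, hk, Category.comp_id]

/-- The chosen left adjoint is known only by its universal property, whereas control of the cone
comes from an explicit triangle. Comparing the two reflections shows that the unit has its cone in
`P`. -/
theorem exists_trW_reflector [P.rightOrthogonal.ι.IsRightAdjoint] {g : X ⟶ Y} (hg : P.trW g)
    (hY : P.rightOrthogonal Y) :
    ∃ u : X ⟶ (P.rightOrthogonal.ι.leftAdjoint ⋙ P.rightOrthogonal.ι).obj X, P.trW u := by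
  let adj := Adjunction.ofIsRightAdjoint P.rightOrthogonal.ι
  let u := adj.unit.app X
  let Z : P.rightOrthogonal.FullSubcategory := P.rightOrthogonal.ι.leftAdjoint.obj X
  have hu (W : P.rightOrthogonal.FullSubcategory) :
      Function.Bijective fun k : Z ⟶ W => u ≫ k.hom := (adj.homEquiv X W).bijective
  obtain ⟨k, hk : g ≫ k = u⟩ := (trW_precomp_bijective P hg Z.2).2 u
  obtain ⟨l, hl : u ≫ l.hom = g⟩ := (hu ⟨Y, hY⟩).2 g
  have h1 : k ≫ l.hom = 𝟙 Y := (trW_precomp_bijective P hg hY).1 (by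
    change g ≫ k ≫ l.hom = g ≫ 𝟙 Y
    rw [reassoc_of% hk, hl, Category.comp_id])
  have h2 : l ≫ ObjectProperty.homMk k = 𝟙 Z := (hu Z).1 (by
    change u ≫ l.hom ≫ k = u ≫ 𝟙 Z.obj
    rw [reassoc_of% hl, hk]
    exact (Category.comp_id u).symm)
  have : IsIso k := ⟨l.hom, h1, congrArg (·.hom) h2⟩
  exact ⟨u, hk ▸ MorphismProperty.RespectsIso.postcomp _ k g hg⟩

theorem le_leftOrthogonal_rightOrthogonal : P ≤ P.rightOrthogonal.leftOrthogonal :=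
  fun _ hX _ f hY => hY f hX

/-- The dual comparison: a map from an object of `P` with cone in the right orthogonal is a
coreflection. -/
theorem nonempty_coreflector_iso [P.ι.IsLeftAdjoint] {f : Y ⟶ X}
    (hf : P.rightOrthogonal.trW f) (hY : P Y) :
    Nonempty ((P.ι.rightAdjoint ⋙ P.ι).obj X ≅ Y) := by
  let adj := Adjunction.ofIsLeftAdjoint P.ι
  let u := adj.counit.app X
  let Z : P.FullSubcategory := P.ι.rightAdjoint.obj X
  have hu (W : P.FullSubcategory) :
      Function.Bijective fun k : W ⟶ Z => k.hom ≫ u := (adj.homEquiv W X).symm.bijective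
  have hf' {A : C} (hA : P A) := trW_postcomp_bijective P.rightOrthogonal hf
    (le_leftOrthogonal_rightOrthogonal P A hA)
  obtain ⟨k, hk : k ≫ f = u⟩ := (hf' Z.2).2 u
  obtain ⟨l, hl : l.hom ≫ u = f⟩ := (hu ⟨Y, hY⟩).2 f
  have h1 : l.hom ≫ k = 𝟙 Y := (hf' hY).1 (by
    change (l.hom ≫ k) ≫ f = 𝟙 Y ≫ f
    rw [Category.assoc, hk, hl, Category.id_comp])
  have h2 : ObjectProperty.homMk k ≫ l = 𝟙 Z := (hu Z).1 (by
    change (k ≫ l.hom) ≫ u = 𝟙 Z.obj ≫ u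
    rw [Category.assoc, hl, hk, Category.id_comp])
  exact ⟨⟨k, l.hom, congrArg (·.hom) h2, h1⟩⟩

end

/-! ### Tensor products with torsion, local and complete objects -/

section
variable [MonoidalCategory C] [∀ X : C, (tensorLeft X).CommShift ℤ]
  [∀ X : C, (tensorLeft X).IsTriangulated]

theorem isZero_tensorLeft (X : C) {Y : C} (hY : IsZero Y) : IsZero (X ⊗ Y) :=
  (tensorLeft X).map_isZero hY

theorem trW_whiskerLeft {P Q : ObjectProperty C} (K : C) (h : ∀ X, P X → Q (K ⊗ X)) {X Y : C}
    {f : X ⟶ Y} (hf : P.trW f) [Q.IsTriangulated] [Q.IsClosedUnderIsomorphisms] : Q.trW (K ◁ f) :=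
  (Q.inverseImage_trW_iff (tensorLeft K) f).1 (ObjectProperty.trW_monotone h f hf)

theorem isIso_whiskerLeft_of_trW {P : ObjectProperty C} (K : C)
    (h : ∀ X, P X → IsZero (K ⊗ X)) {X Y : C} {f : X ⟶ Y} (hf : P.trW f) : IsIso (K ◁ f) := by
  obtain ⟨Z, g, k, hT, hZ⟩ := (P.trW_iff f).1 hf
  exact (Triangle.isZero₃_iff_isIso₁ _ ((tensorLeft K).map_distinguished _ hT)).1 (h Z hZ)

end

theorem rightOrthogonal_pi (P : ObjectProperty C) {J : Type*} {Y : J → C}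
    [HasProduct Y] (h : ∀ j, P.rightOrthogonal (Y j)) : P.rightOrthogonal (∏ᶜ Y) :=
  fun W f hW => Pi.hom_ext _ _ fun j => by rw [zero_comp]; exact h j _ hW

variable [MonoidalCategory C] [HasCoproducts.{v} C] [SymmetricCategory C] [MonoidalClosed C]
  [∀ X : C, (tensorLeft X).CommShift ℤ] [∀ X : C, (tensorLeft X).IsTriangulated]
  [IsRigidlyCompactlyGenerated C]

theorem trW_torsion_whiskerLeft {V : Set (Spc C)} (K : C) {X Y : C} {f : X ⟶ Y}
    (hf : (torsionObjects V).trW f) : (torsionObjects V).trW (K ◁ f) :=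
  trW_whiskerLeft K (fun _ h => IsLocalizingIdeal.tensor_mem _ _ h) hf

theorem localization_obj_mem (U : Set (Spc C)) (X : C) : localObjects U ((localization U).obj X) :=
  ((localObjects U).ι.leftAdjoint.obj X).2

theorem torsion_obj_mem (V : Set (Spc C)) (X : C) : torsionObjects V ((torsion V).obj X) :=
  ((torsionObjects V).ι.rightAdjoint.obj X).2

theorem exists_trW_localization (U : Set (Spc C)) (X : C) :
    ∃ u : X ⟶ (localization U).obj X, (torsionObjects Uᶜ).trW u := by
  obtain ⟨T, Y, f, g, h, hT, hP, hY⟩ := exists_torsion_triangle U X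
  have : (torsionObjects Uᶜ).rightOrthogonal.ι.IsRightAdjoint :=
    inferInstanceAs (localObjects U).ι.IsRightAdjoint
  exact exists_trW_reflector (torsionObjects Uᶜ) (.mk' _ hT hP) hY

theorem exists_trW_completion (V : Set (Spc C)) (X : C) :
    ∃ u : X ⟶ (completion V).obj X, (localObjects Vᶜ).trW u := by
  obtain ⟨T, Y, f, g, h, hT, hP, hY⟩ := exists_completion_triangle V X
  have : (localObjects Vᶜ).rightOrthogonal.ι.IsRightAdjoint :=
    inferInstanceAs (completeObjects V).ι.IsRightAdjoint
  exact exists_trW_reflector (localObjects Vᶜ) (.mk' _ hT hP) hY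

/-- The torsion functor is smashing. -/
theorem nonempty_torsion_iso (V : Set (Spc C)) (X : C) :
    Nonempty ((torsion V).obj X ≅ X ⊗ (torsion V).obj (𝟙_ C)) := by
  obtain ⟨T, Y, f, g, h, hT, hP, hY⟩ := exists_torsion_triangle Vᶜ (𝟙_ C)
  rw [compl_compl] at hP
  have hf : (localObjects Vᶜ).trW f := .mk _ hT hY
  have hl : localObjects Vᶜ = (torsionObjects V).rightOrthogonal := by
    rw [localObjects, compl_compl]
  obtain ⟨e⟩ := nonempty_coreflector_iso (torsionObjects V) (hl ▸ hf) hP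
  have hXf : (localObjects Vᶜ).trW (X ◁ f ≫ (ρ_ X).hom) :=
    MorphismProperty.RespectsIso.postcomp _ _ _
      (trW_whiskerLeft X (fun _ h => localObjects_tensor _ h X) hf)
  obtain ⟨e'⟩ := nonempty_coreflector_iso (torsionObjects V) (hl ▸ hXf)
    (IsLocalizingIdeal.tensor_mem X T hP)
  exact ⟨e' ≪≫ whiskerLeftIso X e.symm⟩

/-- Tensoring with a torsion object inverts maps that Koszul objects invert. -/
theorem isIso_whiskerLeft_of_isKoszul {V : Set (Spc C)} {X Y : C} (f : X ⟶ Y)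
    (h : ∀ p ∈ V, ∀ K, p.IsKoszul K → IsIso (K ◁ f)) {T : C} (hT : torsionObjects V T) :
    IsIso (T ◁ f) := by
  obtain ⟨Z, g, k, hd⟩ := distinguished_cocone_triangle f
  have hz (K : C) : IsZero (K ⊗ Z) ↔ IsIso (K ◁ f) :=
    Triangle.isZero₃_iff_isIso₁ _ ((tensorLeft K).map_distinguished _ hd)
  -- The zero objects, written as a left orthogonal so that they are visibly localizing. The objects
  -- annihilating the cone `Z` then form a localizing ideal, which contains all torsion objects once
  -- it contains the Koszul generators.
  let P : ObjectProperty C := (⊤ : ObjectProperty C).leftOrthogonal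
  have hP (X : C) : P X ↔ IsZero X := by
    rw [IsZero.iff_id_eq_zero]
    exact ⟨fun h => h _ trivial, fun h Y f _ => by rw [← Category.id_comp f, h, zero_comp]⟩
  have : IsLocalizing P := isLocalizing_leftOrthogonal _
  have hI : IsLocalizingIdeal (P.inverseImage (tensorLeft Z)) :=
    { toIsLocalizing := isLocalizing_inverseImage P _
      tensor_mem := fun A B hB => (hP _).2 <| (isZero_tensorLeft A ((hP _).1 hB)).of_iso <|
        (α_ Z A B).symm ≪≫ whiskerRightIso (β_ Z A) B ≪≫ α_ A Z B }
  rw [← hz]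
  exact ((hP _).1 (hT (P.inverseImage (tensorLeft Z)) hI fun p hp K hK =>
    (hP _).2 (((hz K).2 (h p hp K hK)).of_iso (β_ Z K)))).of_iso (β_ T Z)

/-- If tensoring with a rigid object kills all factors of a product but one, then it makes the
projection to that factor invertible. -/
theorem isIso_whiskerLeft_π {K : C} (hK : compactObjects C K) {J : Type*} (Y : J → C)
    [HasProduct Y] (j : J) (h : ∀ k, k ≠ j → IsZero (K ⊗ Y k)) : IsIso (K ◁ Pi.π Y j) := by
  classical
  obtain ⟨K', -, ⟨_⟩⟩ := exists_dual hK
  -- Rigidity enters here: tensoring with `K` is right adjoint to tensoring with its dual, so it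
  -- preserves the product.
  have : (tensorLeft K).IsRightAdjoint := ⟨_, ⟨tensorLeftAdjunction K K'⟩⟩
  let c := isLimitOfPreserves (tensorLeft K) (limit.isLimit (Discrete.functor Y))
  have hext {W : C} (a b : W ⟶ K ⊗ ∏ᶜ Y) (hab : a ≫ K ◁ Pi.π Y j = b ≫ K ◁ Pi.π Y j) : a = b := by
    refine c.hom_ext fun ⟨k⟩ => ?_
    by_cases hk : k = j
    · subst hk; exact hab
    · exact (h k hk).eq_of_tgt _ _
  let i : Y j ⟶ ∏ᶜ Y := Pi.lift fun k => if e : j = k then eqToHom (by rw [e]) else 0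
  have hi : K ◁ i ≫ K ◁ Pi.π Y j = 𝟙 _ := by
    rw [← MonoidalCategory.whiskerLeft_comp]
    simp [i]
  exact ⟨K ◁ i, hext _ _ (by rw [Category.assoc, hi]; simp), hi⟩

end

/-! ### Comparison on the stratum of dimension `i` -/

section
variable {C : Type u} [Category.{v} C] [Preadditive C] [HasZeroObject C] [HasShift C ℤ]
  [∀ n : ℤ, (shiftFunctor C n).Additive] [Pretriangulated C]
  [HasCoproducts.{v} C] [MonoidalCategory C] [SymmetricCategory C] [MonoidalClosed C]
  [∀ X : C, (tensorLeft X).CommShift ℤ] [∀ X : C, (tensorLeft X).IsTriangulated]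
  [IsRigidlyCompactlyGenerated C]

theorem Spc.supp_dual_subset {K K' : C} [ExactPairing K K'] (hK' : compactObjects C K') :
    supp K' ⊆ supp K := fun p hp hK => by
  let := BraidedCategory.exactPairing_swap K K'
  obtain ⟨r⟩ := retract_tensor_dual (K := K') (K' := K)
  exact hp (p.carrier.prop_of_retract r (p.carrier.prop_of_iso
    (β_ K' (K' ⊗ K)) (p.tensor_mem K' _ hK' (p.tensor_mem K' K hK' hK))))

/-- By duality a map `W ⟶ K ⊗ Y` amounts to a map `K' ⊗ W ⟶ Y`, so it suffices that `K' ⊗ W` is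
torsion for the primes of dimension below `i`. For a generator at `q ∉ U`, a point `r` of the
support lies below both `p` and `q`. It cannot be `p`, since then `q ≥ p` would lie in `U`; so `r <
p` has dimension below `i`. -/
theorem localObjects_tensor_of_isKoszul [TopologicalSpace.NoetherianSpace (Spc C)] {p : Spc C}
    {K : C} (hK : p.IsKoszul K) {i : ℕ} (hp : Order.height p = i) {U : Set (Spc C)}
    (hU : Set.Ici p ⊆ U) {Y : C} (hY : localObjects {q : Spc C | (i : ℕ∞) ≤ Order.height q} Y) :
    localObjects U (K ⊗ Y) := by
  obtain ⟨K', hK', ⟨_⟩⟩ := exists_dual hK.1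
  intro W f hW
  have hI : IsLocalizingIdeal ((torsionObjects {q : Spc C | (i : ℕ∞) ≤ Order.height q}ᶜ).inverseImage
      (tensorLeft K')) :=
    { toIsLocalizing := isLocalizing_inverseImage _ _
      tensor_mem := fun A B hB => (torsionObjects _).prop_of_iso
        (show A ⊗ (K' ⊗ B) ≅ K' ⊗ (A ⊗ B) from (α_ A K' B).symm ≪≫ whiskerRightIso (β_ A K') B ≪≫ α_ K' A B)
        (IsLocalizingIdeal.tensor_mem (P := torsionObjects _) A (K' ⊗ B) hB) }
  have hKW : torsionObjects {q : Spc C | (i : ℕ∞) ≤ Order.height q}ᶜ (K' ⊗ W) := by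
    refine hW _ hI fun q hq L hL => torsionObjects_of_supp_subset (compact_tensor hK' hL.1) ?_
    intro r hr hri
    have hrp : r ≤ p := (Spc.le_iff_mem_closure r p).2
      (hK.2 ▸ Spc.supp_dual_subset hK' (Spc.supp_tensor_subset_left K' hL.1 hr))
    have hrq : r ≤ q := (Spc.le_iff_mem_closure r q).2
      (hL.2 ▸ Spc.supp_tensor_subset_right hK' L hr)
    obtain rfl | hlt := hrp.eq_or_lt
    · exact hq (hU hrq)
    · have hri : (i : ℕ∞) ≤ Order.height r := hri
      refine (Order.height_strictMono hlt ?_).not_ge (hp.trans_le hri)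
      -- Strict monotonicity of height holds only at finite height.
      exact (Order.height_mono hlt.le).trans_lt (hp ▸ ENat.natCast_lt_top i)
  apply (tensorLeftHomEquiv W K K' Y).symm.injective
  exact (hY _ hKW).trans (hY _ hKW).symm

namespace AssemblyData
variable [HasProducts.{v} C] (A : AssemblyData C)

/-- Since `α` preserves dimension, every prime with `α p ≥ x` has dimension at least `i`; locality
for the smaller set is the stronger condition. -/
theorem localObjects_localizationAt {i : ℕ} (x : A.OfDim i) (X : C) :
    localObjects {q : Spc C | (i : ℕ∞) ≤ Order.height q} ((A.localizationAt x.1).obj X) := by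
  intro W f hW
  refine localization_obj_mem (A.α ⁻¹' Set.Ici x.1) X f fun P hP h => hW P hP fun p hp => h p ?_
  intro hx
  refine hp ?_
  have := Order.height_mono (show x.1 ≤ A.α p from hx)
  rwa [x.2, A.height_α] at this

theorem localObjects_pi_localizationAt (i : ℕ) (M : A.OfDim i → C) :
    localObjects {q : Spc C | (i : ℕ∞) ≤ Order.height q}
      (∏ᶜ fun x => (A.localizationAt x.1).obj (M x)) :=
  rightOrthogonal_pi _ fun x => A.localObjects_localizationAt x (M x)

theorem nonempty_tensor_iso [TopologicalSpace.NoetherianSpace (Spc C)] (i : ℕ) {X : C}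
    {M : A.OfDim i → C} (m : ∀ x, X ⟶ M x)
    (hm : ∀ x p K, p.IsKoszul K → A.α p = x.1 → IsIso (K ◁ m x)) :
    Nonempty ((torsionLE C i).obj (𝟙_ C) ⊗ (X ⊗ (localizationGE C i).obj (𝟙_ C)) ≅
      (torsionLE C i).obj (𝟙_ C) ⊗ ∏ᶜ fun x => (A.localizationAt x.1).obj (M x)) := by
  let U : Set (Spc C) := {q | (i : ℕ∞) ≤ Order.height q}
  obtain ⟨u, hu⟩ := exists_trW_localization U (𝟙_ C)
  have hL : localObjects U (X ⊗ (localization U).obj (𝟙_ C)) :=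
    localObjects_tensor U (localization_obj_mem U _) X
  let w : X ⟶ X ⊗ (localization U).obj (𝟙_ C) := (ρ_ X).inv ≫ X ◁ u
  have hw : (torsionObjects Uᶜ).trW w :=
    MorphismProperty.RespectsIso.precomp _ _ _ (trW_torsion_whiskerLeft X hu)
  choose l hl using fun x : A.OfDim i =>
    exists_trW_localization (A.α ⁻¹' Set.Ici x.1) (M x)
  -- Each localization at `x` is `{≥i}`-local, so `X ⟶ M x ⟶ L_x (M x)` extends uniquely along the
  -- `{≥i}`-localization `w` of `X`.
  choose φ hφ using fun x : A.OfDim i => (trW_precomp_bijective _ hw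
    (A.localObjects_localizationAt x (M x))).2 (m x ≫ l x)
  have key : IsIso ((torsionLE C i).obj (𝟙_ C) ◁ Pi.lift φ) := by
    refine isIso_whiskerLeft_of_isKoszul (Pi.lift φ) ?_ (torsion_obj_mem {p | Order.height p ≤ i} _)
    intro p hp K hK
    obtain hlt | heq := lt_or_eq_of_le (show Order.height p ≤ i from hp)
    · have hKt : torsionObjects Uᶜ K :=
        torsionObjects_of_isKoszul (show p ∈ Uᶜ from not_le_of_gt hlt) hK
      have hz {Y : C} (hY : localObjects U Y) : IsZero (K ⊗ Y) :=
        (isZero_tensor hKt hY).of_iso (β_ K Y)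
      exact ⟨0, (hz hL).eq_of_src _ _, (hz (A.localObjects_pi_localizationAt i M)).eq_of_src _ _⟩
    · let x : A.OfDim i := ⟨A.α p, (A.height_α p).trans heq⟩
      let Ux : Set (Spc C) := A.α ⁻¹' Set.Ici x.1
      have hUx : Set.Ici p ⊆ Ux := fun q hq => A.α.monotone hq
      have hUU : torsionObjects Uᶜ ≤ torsionObjects Uxᶜ := fun W hW P hP h =>
        hW P hP fun q hq => h q fun hqx => hq <| by
          have := Order.height_mono (show x.1 ≤ A.α q from hqx)
          rwa [x.2, A.height_α] at this
      -- For `y ≠ x` of the same finite dimension `y ≤ x` fails, so `p` lies outside the region of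
      -- `y` and `K` annihilates that factor.
      have hπ : IsIso (K ◁ Pi.π (fun x => (A.localizationAt x.1).obj (M x)) x) := by
        refine isIso_whiskerLeft_π hK.1 _ x fun y hy => ?_
        have hKt : torsionObjects (A.α ⁻¹' Set.Ici y.1)ᶜ K := by
          refine torsionObjects_of_isKoszul (show p ∈ (A.α ⁻¹' Set.Ici y.1)ᶜ from
            fun hyp : y.1 ≤ x.1 => hy ?_) hK
          refine Subtype.ext (hyp.eq_of_not_lt fun hlt => ?_)
          refine (Order.height_strictMono hlt ?_).ne (y.2.trans x.2.symm)
          exact y.2.trans_lt (ENat.natCast_lt_top i)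
        exact (isZero_tensor hKt (localization_obj_mem _ _)).of_iso (β_ K _)
      have := hm x p K hK rfl
      -- Source and target are both reflections of `K ⊗ X` into the objects local at `x`: the source
      -- is local because `K` is Koszul at `p`, and `K ◁ m x` is invertible by hypothesis.
      have hφx : IsIso (K ◁ φ x) := by
        refine isIso_of_trW_comp (torsionObjects Uxᶜ) (g := K ◁ w) (g' := K ◁ m x ≫ K ◁ l x)
          (trW_torsion_whiskerLeft K (ObjectProperty.trW_monotone hUU _ hw))
          (localObjects_tensor_of_isKoszul hK heq hUx hL)
          (MorphismProperty.RespectsIso.precomp _ _ _ (trW_torsion_whiskerLeft K (hl x)))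
          (localObjects_tensor Ux (localization_obj_mem Ux _) K) _ ?_
        exact (MonoidalCategory.whiskerLeft_comp K w (φ x)).symm.trans
          ((congrArg (K ◁ ·) (hφ x)).trans (MonoidalCategory.whiskerLeft_comp K (m x) (l x)))
      have hcomp : K ◁ Pi.lift φ ≫ K ◁ Pi.π _ x = K ◁ φ x := by
        rw [← MonoidalCategory.whiskerLeft_comp, Pi.lift_π]
      exact IsIso.of_isIso_fac_right hcomp
  exact ⟨@asIso _ _ _ _ _ key⟩

end AssemblyData

theorem nonempty_E_tensor_iso (i : ℕ) (X : C) :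
    Nonempty (E C i ⊗ X ≅
      (torsionLE C i).obj (𝟙_ C) ⊗ (X ⊗ (localizationGE C i).obj (𝟙_ C))) := by
  obtain ⟨e⟩ := nonempty_torsion_iso {p : Spc C | Order.height p ≤ i}
    ((localizationGE C i).obj (𝟙_ C))
  let T := (torsionLE C i).obj (𝟙_ C)
  let L := (localizationGE C i).obj (𝟙_ C)
  exact ⟨whiskerRightIso (show E C i ≅ L ⊗ T from e) X ≪≫ whiskerRightIso (β_ L T) X ≪≫
    α_ T L X ≪≫ whiskerLeftIso T (β_ L X)⟩

end

end TTGeometry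

/-! ### The two isomorphisms -/

theorem mainTheorem9 {C : Type u} [Category.{v} C] [Preadditive C] [HasZeroObject C]
    [HasShift C ℤ] [∀ n : ℤ, (shiftFunctor C n).Additive] [Pretriangulated C] [IsTriangulated C]
    [HasCoproducts.{v} C] [HasProducts.{v} C]
    [MonoidalCategory C] [SymmetricCategory C] [MonoidalClosed C]
    [∀ X : C, (tensorLeft X).CommShift ℤ] [∀ X : C, (tensorLeft X).IsTriangulated]
    [TTGeometry.IsRigidlyCompactlyGenerated C]
    [TopologicalSpace.NoetherianSpace (TTGeometry.Spc C)]
    (d : ℕ) (hd : topologicalKrullDim (TTGeometry.Spc C) = d)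
    (A : TTGeometry.AssemblyData C) (i : ℕ) (hi : i ≤ d) :
    (∀ X : C, Nonempty
      ((TTGeometry.torsionLE C i).obj (∏ᶜ fun x : A.OfDim i => (A.localizationAt x.1).obj X) ≅
        TTGeometry.E C i ⊗ X)) ∧
    Nonempty (TTGeometry.E C i ≅ TTGeometry.E C i ⊗ A.adelicRing i) := by
  let T := (TTGeometry.torsionLE C i).obj (𝟙_ C)
  constructor
  · intro X
    obtain ⟨e₁⟩ := TTGeometry.nonempty_torsion_iso {p : TTGeometry.Spc C | Order.height p ≤ i}
      (∏ᶜ fun x : A.OfDim i => (A.localizationAt x.1).obj X)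
    obtain ⟨e₂⟩ := TTGeometry.nonempty_E_tensor_iso i X
    obtain ⟨e₃⟩ := A.nonempty_tensor_iso i (X := X) (M := fun _ => X) (fun _ => 𝟙 X)
      fun _ _ _ _ _ => inferInstance
    exact ⟨e₁ ≪≫ β_ _ T ≪≫ e₃.symm ≪≫ e₂.symm⟩
  · choose m hm using fun x : A.OfDim i =>
      TTGeometry.exists_trW_completion (A.α ⁻¹' Set.Iic x.1) (𝟙_ C)
    obtain ⟨e₁⟩ := TTGeometry.nonempty_E_tensor_iso i (𝟙_ C)
    obtain ⟨e₂⟩ := TTGeometry.nonempty_E_tensor_iso i (A.adelicRing i)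
    -- The cone of completion at `x` is local away from the primes with `α p ≤ x`, so a Koszul
    -- object of a prime over `x`, being torsion there, annihilates it.
    obtain ⟨e₃⟩ := A.nonempty_tensor_iso i m fun x p K hK hp =>
      TTGeometry.isIso_whiskerLeft_of_trW K (fun Y hY => by
        have hKt : TTGeometry.torsionObjects (A.α ⁻¹' Set.Iic x.1)ᶜᶜ K :=
          TTGeometry.torsionObjects_of_isKoszul (by rw [compl_compl]; exact hp.le) hK
        exact (TTGeometry.isZero_tensor hKt hY).of_iso (β_ K Y)) (hm x)
    let U : Set (TTGeometry.Spc C) := {q | (i : ℕ∞) ≤ Order.height q}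
    obtain ⟨u, hu⟩ := TTGeometry.exists_trW_localization U (𝟙_ C)
    have hA : TTGeometry.localObjects U (A.adelicRing i) := A.localObjects_pi_localizationAt i _
    -- The adelic ring is already `{≥i}`-local, so this localization map is compared with the
    -- identity, another reflection of the same object.
    have hiso : IsIso (A.adelicRing i ◁ u) :=
      TTGeometry.isIso_of_trW_comp (TTGeometry.torsionObjects Uᶜ) (g := 𝟙 _)
        (ObjectProperty.trW_of_isIso _ _) (ObjectProperty.prop_of_iso _ (ρ_ _).symm hA)
        (TTGeometry.trW_torsion_whiskerLeft _ hu)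
        (TTGeometry.localObjects_tensor U (TTGeometry.localization_obj_mem U _) _) _
        (Category.id_comp _)
    exact ⟨(ρ_ _).symm ≪≫ e₁ ≪≫ e₃ ≪≫ whiskerLeftIso T
      ((ρ_ _).symm ≪≫ @asIso _ _ _ _ _ hiso) ≪≫ e₂.symm⟩
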